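/- Let $r\ge 3$ be an integer, $q=e^{2\pi i/r}$, and for $k\in\mathbb Z$ let $[k]=\frac{q^{k/2}-q^{-k/2}}{q^{1/2}-q^{-1/2}}$ with $q^{1/2}=e^{\pi i/r}$; put $\beta=[2]^2$. A $(2,r)$-diagram is a Young diagram $\lambda=[\lambda_1,\lambda_2]$ with at most two rows and $\lambda_1-\lambda_2\le r-2$. For such a $\lambda$ with $n$ boxes let $T_\lambda$ be the set of standard tableaux $t$ of shape $\lambda$ such that, when $n,n-1,\dots,1$ are deleted from $t$ one at a time, every tableau that appears has a $(2,r)$-diagram as its shape, and let $V_\lambda$ be the complex Hilbert space with orthonormal basis $\{v_t: t\in T_\lambda\}$. If $i$ is in row $r_1$ and column $c_1$ of $t$, and $i+1$ in row $r_2$ and column $c_2$, put $d=c_1-c_2-(r_1-r_2)$, $\alpha_{t,i}=\frac{[d+1]}{[2][d]}$, $\beta_{t,i}=\sqrt{\alpha_{t,i}(1-\alpha_{t,i})}$, and for $1\le i\le n-1$ define $$e_i v_t=\alpha_{t,i}v_t+\beta_{t,i}v_{g_i(t)},$$ where $g_i(t)$ is $t$ with $i$ and $i+1$ exchanged, and the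 second term is omitted if $g_i(t)\notin T_\lambda$. Let $B_n$ be the braid group with its standard generators $\sigma_1,\dots,\sigma_{n-1}$. The sector $\rho_{\lambda,\beta,n}:B_n\to \mathbf U(V_\lambda)$ of the Jones representation is the unitary representation with $\rho_{\lambda,\beta,n}(\sigma_i)=q-(1+q)e_i$. Then: (i) For every $r\ge3$ and every $(2,r)$-diagram $\lambda$ with $n$ boxes, $\rho_{\lambda,\beta,n}$ is irreducible. (ii) If $r\ne 3,4,6,10$, $n\ge 3$ and $\lambda_2\ge 1$, then the subgroup $H$ of $\mathbf U(V_\lambda)$ generated by $\rho_{\lambda,\beta,n}(\sigma_1)$ and $\rho_{\lambda,\beta,n}(\sigma_2)$ is infinite modulo centre: its image in $\mathbf U(V_\lambda)/Z(\mathbf U(V_\lambda))$ is infinite, and so is $H/Z(H)$. (For $\lambda=[2,1]$, $n=3$, the group $\mathbf U(V_\lambda)$ is $\mathbf U(2)$.) (iii) The numbers $-1$ and $q$ are distinct, and every eigenvalue of $\rho_{\lambda,\beta,n}(\sigma_i)$, $1\le i\le n-1$, is $-1$ or $q$. If $r\ge4$, $n\ge3$ and $\lambda_2\ge1$, then both occur,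 so that $\rho_{\lambda,\beta,n}(\sigma_i)$ has exactly the two distinct eigenvalues $-1$ and $q$. (iv) For $r=5$, $\lambda=[4,2]$, $n=6$, the eigenvalues $-1$ and $q$ of every $\rho_{\lambda,\beta,6}(\sigma_i)$, $1\le i\le 5$, have multiplicities $3$ and $5$, respectively. -/

import Mathlib

namespace JonesSector

/-! ### The braid group -/

/-- The relators of the `n`-strand braid group.  The index `i : Fin (n - 1)` stands for the
generator usually written `σ_{i+1}`. -/
def braidRels (n : ℕ) : Set (FreeGroup (Fin (n - 1))) :=
  {w | ∃ i j : Fin (n - 1), (i.val + 1 < j.val ∨ j.val + 1 < i.val) ∧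
      w = FreeGroup.of i * FreeGroup.of j * (FreeGroup.of i)⁻¹ * (FreeGroup.of j)⁻¹} ∪
  {w | ∃ i j : Fin (n - 1), (i.val + 1 = j.val ∨ j.val + 1 = i.val) ∧
      w = FreeGroup.of i * FreeGroup.of j * FreeGroup.of i *
        (FreeGroup.of j * FreeGroup.of i * FreeGroup.of j)⁻¹}

/-- The `n`-strand braid group, by its Artin presentation. -/
abbrev BraidGroup (n : ℕ) : Type := PresentedGroup (braidRels n)

/-- The standard generators; `σ i` is `σ_{i+1}` in one-based numbering. -/
def BraidGroup.σ {n : ℕ} (i : Fin (n - 1)) : BraidGroup n := PresentedGroup.of i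

/-! ### Diagrams and tableaux -/

/-- `(2,r)`-diagrams: at most two rows, and `λ₁ - λ₂ ≤ r - 2`. -/
def IsTwoRow (r : ℕ) (μ : YoungDiagram) : Prop :=
  μ.colLen 0 ≤ 2 ∧ (μ.rowLen 0 : ℤ) - μ.rowLen 1 ≤ (r : ℤ) - 2

/-- Standard tableaux of shape `μ` with `n` boxes such that, when the largest entries are deleted
one at a time, every tableau that appears has a `(2,r)`-diagram as its shape.  The tableau is
recorded by the cell `(row, column)` in which each entry sits; the entry usually written `j + 1`
is `j : Fin n`, and rows and columns are counted from `0`. -/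
@[ext]
structure Tableau (r n : ℕ) (μ : YoungDiagram) where
  cell : Fin n ≃ μ.cells
  standard : ∀ j k : Fin n, (cell j : ℕ × ℕ) ≤ cell k → j ≤ k
  truncation : ∀ m ≤ n, ∃ ν : YoungDiagram, IsTwoRow r ν ∧
    ∀ c : ℕ × ℕ, c ∈ ν ↔ ∃ j : Fin n, j.val < m ∧ (cell j : ℕ × ℕ) = c

noncomputable instance (r n : ℕ) (μ : YoungDiagram) : DecidableEq (Tableau r n μ) :=
  Classical.decEq _

noncomputable instance (r n : ℕ) (μ : YoungDiagram) : Fintype (Tableau r n μ) :=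
  Fintype.ofInjective Tableau.cell fun _ _ h => Tableau.ext h

/-- The smaller of the two entries exchanged by the `i`-th transposition. -/
def lo {n : ℕ} (i : Fin (n - 1)) : Fin n := ⟨i.val, by omega⟩

/-- The larger of the two entries exchanged by the `i`-th transposition. -/
def hi {n : ℕ} (i : Fin (n - 1)) : Fin n := ⟨i.val + 1, by omega⟩

/-! ### The matrices -/

/-- `q = e^{2πi/r}`. -/
noncomputable def q (r : ℕ) : ℂ := Complex.exp (2 * Real.pi * Complex.I / r)

/-- The quantum integer `[k] = (q^{k/2} - q^{-k/2}) / (q^{1/2} - q^{-1/2})` with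
`q^{1/2} = e^{πi/r}`, as a real number; see `qInt_eq`. -/
noncomputable def qInt (r : ℕ) (k : ℤ) : ℝ :=
  Real.sin (k * (Real.pi / r)) / Real.sin (Real.pi / r)

theorem qInt_eq (r : ℕ) (k : ℤ) :
    (qInt r k : ℂ) =
      (Complex.exp (Real.pi * Complex.I / r) ^ k - Complex.exp (Real.pi * Complex.I / r) ^ (-k)) /
      (Complex.exp (Real.pi * Complex.I / r) - (Complex.exp (Real.pi * Complex.I / r))⁻¹) := by
  have h : ∀ x : ℂ, Complex.exp (x * Complex.I) - Complex.exp (-(x * Complex.I)) =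
      Complex.sin x * (2 * Complex.I) := by
    intro x
    rw [Complex.sin, neg_mul]
    linear_combination (-(Complex.exp (-(x * Complex.I)) - Complex.exp (x * Complex.I))) *
      Complex.I_sq
  have e1 : (Real.pi * Complex.I / r : ℂ) = (Real.pi / r : ℂ) * Complex.I := by ring
  rw [← Complex.exp_int_mul, ← Complex.exp_int_mul, ← Complex.exp_neg, e1, h]
  have e2 : ((k : ℂ) * ((Real.pi / r : ℂ) * Complex.I)) = (k * (Real.pi / r)) * Complex.I := by
    ring
  have e3 : (((-k : ℤ) : ℂ) * ((Real.pi / r : ℂ) * Complex.I)) =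
      -((k * (Real.pi / r)) * Complex.I) := by push_cast; ring
  rw [e2, e3, h, mul_div_mul_right _ _ (by simp), qInt]
  push_cast
  rfl

namespace Tableau

variable {r n : ℕ} {μ : YoungDiagram}

/-- `d_{t,i} = c₁ - c₂ - (r₁ - r₂)`, where the entries `i`, `i+1` sit in row `r₁`, `r₂` and
column `c₁`, `c₂`. -/
def d (t : Tableau r n μ) (i : Fin (n - 1)) : ℤ :=
  ((t.cell (lo i) : ℕ × ℕ).2 : ℤ) - ((t.cell (hi i) : ℕ × ℕ).2 : ℤ) -
    (((t.cell (lo i) : ℕ × ℕ).1 : ℤ) - ((t.cell (hi i) : ℕ × ℕ).1 : ℤ))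

/-- `α_{t,i} = [d_{t,i} + 1] / ([2] [d_{t,i}])`. -/
noncomputable def alpha (t : Tableau r n μ) (i : Fin (n - 1)) : ℝ :=
  qInt r (t.d i + 1) / (qInt r 2 * qInt r (t.d i))

/-- `β_{t,i} = √(α_{t,i} (1 - α_{t,i}))`. -/
noncomputable def beta (t : Tableau r n μ) (i : Fin (n - 1)) : ℝ :=
  Real.sqrt (t.alpha i * (1 - t.alpha i))

/-- The filling obtained from `t` by exchanging the entries `i` and `i+1`. -/
def swapped (t : Tableau r n μ) (i : Fin (n - 1)) : Fin n ≃ μ.cells :=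
  (Equiv.swap (lo i) (hi i)).trans t.cell

end Tableau

/-- The matrix of the `i`-th Temperley-Lieb-Jones projector in the basis `v_t`:
`e_i v_t = α_{t,i} v_t + β_{t,i} v_{g_i(t)}`, where the second term is absent if the filling
`g_i(t)` is not one of the tableaux. -/
noncomputable def projector (r n : ℕ) (μ : YoungDiagram) (i : Fin (n - 1)) :
    Matrix (Tableau r n μ) (Tableau r n μ) ℂ :=
  Matrix.of fun s t =>
    if s = t then (t.alpha i : ℂ)
    else if s.cell = t.swapped i then (t.beta i : ℂ)
    else 0

/-- The matrix `q - (1 + q) e_i`. -/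
noncomputable def sigmaMatrix (r n : ℕ) (μ : YoungDiagram) (i : Fin (n - 1)) :
    Matrix (Tableau r n μ) (Tableau r n μ) ℂ :=
  q r • (1 : Matrix (Tableau r n μ) (Tableau r n μ) ℂ) - (1 + q r) • projector r n μ i

/-! ### Quantum integers -/

section quantum

variable {r : ℕ}

theorem sin_base_pos (hr : 3 ≤ r) : 0 < Real.sin (Real.pi / r) := by
  have h3 : (3 : ℝ) ≤ r := by exact_mod_cast hr
  apply Real.sin_pos_of_pos_of_lt_pi
  · have := Real.pi_pos
    positivity
  · exact div_lt_self Real.pi_pos (by linarith)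

theorem qInt_neg (k : ℤ) : qInt r (-k) = -qInt r k := by
  simp [qInt, neg_div]

theorem qInt_nonneg (hr : 3 ≤ r) {k : ℤ} (h0 : 0 ≤ k) (h1 : k ≤ r) : 0 ≤ qInt r k := by
  have h3 : (3 : ℝ) ≤ r := by exact_mod_cast hr
  have hk0 : (0 : ℝ) ≤ k := by exact_mod_cast h0
  have hk : (k : ℝ) ≤ r := by exact_mod_cast h1
  have := Real.pi_pos
  apply div_nonneg _ (sin_base_pos hr).le
  apply Real.sin_nonneg_of_nonneg_of_le_pi
  · positivity
  · rw [mul_div_assoc', div_le_iff₀ (by linarith)]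
    nlinarith

theorem qInt_pos (hr : 3 ≤ r) {k : ℤ} (h0 : 0 < k) (h1 : k < r) : 0 < qInt r k := by
  have h3 : (3 : ℝ) ≤ r := by exact_mod_cast hr
  have hk0 : (0 : ℝ) < k := by exact_mod_cast h0
  have hk : (k : ℝ) < r := by exact_mod_cast h1
  have := Real.pi_pos
  apply div_pos _ (sin_base_pos hr)
  apply Real.sin_pos_of_pos_of_lt_pi
  · positivity
  · rw [mul_div_assoc', div_lt_iff₀ (by linarith)]
    nlinarith

theorem qInt_ne_zero (hr : 3 ≤ r) {k : ℤ} (h : k ≠ 0) (h0 : -(r : ℤ) < k) (h1 : k < r) :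
    qInt r k ≠ 0 := by
  rcases lt_or_gt_of_ne h with h | h
  · have := qInt_pos hr (k := -k) (by omega) (by omega)
    rw [qInt_neg] at this
    linarith
  · exact (qInt_pos hr h h1).ne'

theorem qInt_one (hr : 3 ≤ r) : qInt r 1 = 1 := by
  simp [qInt, (sin_base_pos hr).ne']

theorem qInt_zero : qInt r 0 = 0 := by simp [qInt]

theorem qInt_two (hr : 3 ≤ r) : qInt r 2 = 2 * Real.cos (Real.pi / r) := by
  have := (sin_base_pos hr).ne'
  rw [qInt]
  push_cast
  rw [Real.sin_two_mul]
  field_simp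

theorem qInt_two_mul (hr : 3 ≤ r) (k : ℤ) :
    qInt r 2 * qInt r k = qInt r (k + 1) + qInt r (k - 1) := by
  rw [qInt_two hr, qInt, qInt, qInt]
  push_cast
  rw [add_mul, sub_mul, Real.sin_add, Real.sin_sub]
  ring_nf

theorem qInt_top_sub (hr : 3 ≤ r) (k : ℤ) : qInt r (r - k) = qInt r k := by
  have h3 : (r : ℝ) ≠ 0 := by positivity
  rw [qInt, qInt]
  congr 1
  rw [← Real.sin_pi_sub]
  congr 1
  push_cast
  field_simp
  ring

/-- `α` as a function of `d`. -/
noncomputable def alphaOf (r : ℕ) (x : ℤ) : ℝ := qInt r (x + 1) / (qInt r 2 * qInt r x)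

theorem two_ne (hr : 3 ≤ r) : qInt r 2 ≠ 0 := qInt_ne_zero hr (by omega) (by omega) (by omega)

theorem alphaOf_neg (hr : 3 ≤ r) {x : ℤ} (hx : qInt r x ≠ 0) :
    alphaOf r (-x) = 1 - alphaOf r x := by
  have h2 := two_ne hr
  have h := qInt_two_mul hr x
  rw [alphaOf, alphaOf, qInt_neg, show -x + 1 = -(x - 1) by ring, qInt_neg]
  field_simp
  linarith

theorem alphaOf_neg_one : alphaOf r (-1) = 0 := by simp [alphaOf, qInt_zero]

theorem alphaOf_one (hr : 3 ≤ r) : alphaOf r 1 = 1 := by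
  have := two_ne hr
  simp [alphaOf, qInt_one hr, this]

theorem alphaOf_bot (hr : 3 ≤ r) : alphaOf r (1 - r) = 1 := by
  have := two_ne hr
  rw [alphaOf, show (1 - (r : ℤ) + 1) = -(r - 2) by ring,
    show (1 - (r : ℤ)) = -(r - 1) by ring, qInt_neg, qInt_neg, qInt_top_sub hr,
    qInt_top_sub hr, qInt_one hr]
  field_simp

theorem alphaOf_mul_nonneg (hr : 3 ≤ r) {x : ℤ} (hx : x ≠ 0) (h0 : -(r : ℤ) < x) (h1 : x < r) :
    0 ≤ alphaOf r x * (1 - alphaOf r x) := by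
  have hne := qInt_ne_zero hr hx h0 h1
  rw [← alphaOf_neg hr hne, alphaOf, alphaOf, qInt_neg,
    show -x + 1 = -(x - 1) by ring, qInt_neg, div_mul_div_comm]
  have key : 0 ≤ qInt r (x + 1) * qInt r (x - 1) := by
    rcases lt_or_gt_of_ne hx with h | h
    · have a := qInt_nonneg hr (k := -(x + 1)) (by omega) (by omega)
      have b := qInt_nonneg hr (k := -(x - 1)) (by omega) (by omega)
      rw [qInt_neg] at a b
      nlinarith
    · exact mul_nonneg (qInt_nonneg hr (by omega) (by omega))
        (qInt_nonneg hr (by omega) (by omega))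
  have e : qInt r (x + 1) * -qInt r (x - 1) / (qInt r 2 * qInt r x * (qInt r 2 * -qInt r x)) =
      qInt r (x + 1) * qInt r (x - 1) / (qInt r 2 * qInt r x) ^ 2 := by
    rw [mul_neg, mul_neg, mul_neg, neg_div_neg_eq, sq]
  rw [e]
  exact div_nonneg key (sq_nonneg _)

theorem alphaOf_braid_left (hr : 3 ≤ r) {x : ℤ} (hx : qInt r x ≠ 0) (hx' : qInt r (x - 1) ≠ 0) :
    alphaOf r (-x) * alphaOf r (x - 1) = (qInt r 2 ^ 2)⁻¹ := by
  have := two_ne hr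
  rw [alphaOf, alphaOf, qInt_neg, show -x + 1 = -(x - 1) by ring, qInt_neg, sub_add_cancel]
  field_simp

theorem alphaOf_braid_right (hr : 3 ≤ r) {x : ℤ} (hx : qInt r x ≠ 0)
    (hx' : qInt r (x + 1) ≠ 0) :
    alphaOf r x * alphaOf r (-1 - x) = (qInt r 2 ^ 2)⁻¹ := by
  have := two_ne hr
  rw [alphaOf, alphaOf, show -1 - x + 1 = -x by ring, show -1 - x = -(x + 1) by ring, qInt_neg,
    qInt_neg]
  field_simp

theorem norm_q (r : ℕ) : q r * star (q r) = 1 := by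
  have e : q r = Complex.exp ((2 * Real.pi / r : ℝ) * Complex.I) := by
    rw [q]
    push_cast
    congr 1
    ring
  have h : ‖q r‖ = 1 := by rw [e, Complex.norm_exp_ofReal_mul_I]
  have := Complex.mul_conj (q r)
  rw [Complex.normSq_eq_norm_sq, h] at this
  simpa using this

theorem q_qInt (hr : 3 ≤ r) : (1 + q r) ^ 2 = q r * ((qInt r 2 : ℝ) : ℂ) ^ 2 := by
  have e : q r = Complex.exp ((Real.pi / r) * Complex.I) ^ 2 := by
    rw [q, ← Complex.exp_nat_mul]
    congr 1
    push_cast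
    ring
  rw [qInt_two hr, e]
  push_cast
  rw [Complex.cos, neg_mul, Complex.exp_neg]
  have := Complex.exp_ne_zero ((Real.pi / r) * Complex.I)
  field_simp
  ring

end quantum

/-! ### Combinatorics of the tableaux -/

/-- The cells filled by the entries below `m` form the two-row shape `[a, b]`. -/
def Shape (r : ℕ) {n : ℕ} {μ : YoungDiagram} (f : Fin n ≃ μ.cells) (m a b : ℕ) : Prop :=
  b ≤ a ∧ a + 2 ≤ b + r ∧ ∀ c : ℕ × ℕ, (∃ j : Fin n, j.val < m ∧ (f j : ℕ × ℕ) = c) ↔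
    (c.1 = 0 ∧ c.2 < a) ∨ (c.1 = 1 ∧ c.2 < b)

theorem exists_shape_iff {r n : ℕ} {μ : YoungDiagram} (f : Fin n ≃ μ.cells) (m : ℕ) :
    (∃ ν : YoungDiagram, IsTwoRow r ν ∧
      ∀ c : ℕ × ℕ, c ∈ ν ↔ ∃ j : Fin n, j.val < m ∧ (f j : ℕ × ℕ) = c) ↔
    ∃ a b, Shape r f m a b := by
  constructor
  · rintro ⟨ν, ⟨h1, h2⟩, h3⟩
    refine ⟨ν.rowLen 0, ν.rowLen 1, ν.rowLen_anti 0 1 (by omega), by omega, ?_⟩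
    rintro ⟨x, y⟩
    rw [← h3]
    constructor
    · intro h
      have hx : x < 2 := by
        have h' : (x, 0) ∈ ν := ν.up_left_mem le_rfl (Nat.zero_le y) h
        rw [YoungDiagram.mem_iff_lt_colLen] at h'
        omega
      rw [YoungDiagram.mem_iff_lt_rowLen] at h
      interval_cases x
      · exact Or.inl ⟨rfl, h⟩
      · exact Or.inr ⟨rfl, h⟩
    · rintro (⟨h, h'⟩ | ⟨h, h'⟩) <;> simp only at h h' <;> subst h <;>
        exact YoungDiagram.mem_iff_lt_rowLen.2 h'
  · rintro ⟨a, b, hab, hr, h⟩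
    have hw : [a, b].SortedGE := by simp [List.sortedGE_iff_pairwise, hab]
    have hmem : ∀ c : ℕ × ℕ, c ∈ YoungDiagram.ofRowLens [a, b] hw ↔
        (c.1 = 0 ∧ c.2 < a) ∨ (c.1 = 1 ∧ c.2 < b) := by
      rintro ⟨x, y⟩
      rw [YoungDiagram.mem_ofRowLens]
      match x with
      | 0 => simp
      | 1 => simp
      | x + 2 => simp
    refine ⟨YoungDiagram.ofRowLens [a, b] hw, ⟨?_, ?_⟩, fun c => by rw [hmem, h]⟩
    · by_contra hc
      have : (2, 0) ∈ YoungDiagram.ofRowLens [a, b] hw :=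
        YoungDiagram.mem_iff_lt_colLen.2 (by omega)
      rw [hmem] at this
      simp at this
    · have h0 := YoungDiagram.rowLen_ofRowLens (w := [a, b]) (hw := hw) ⟨0, by simp⟩
      have h1 := YoungDiagram.rowLen_ofRowLens (w := [a, b]) (hw := hw) ⟨1, by simp⟩
      simp only [Fin.getElem_fin, List.getElem_cons_zero, List.getElem_cons_succ] at h0 h1
      rw [h0, h1]
      omega

namespace Tableau

variable {r n : ℕ} {μ : YoungDiagram}

/-- A filling all of whose truncations have a two-row shape is a tableau. -/
def ofShapes (f : Fin n ≃ μ.cells) (h : ∀ m ≤ n, ∃ a b, Shape r f m a b) : Tableau r n μ where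
  cell := f
  standard j k hjk := by
    obtain ⟨ν, -, hν⟩ := (exists_shape_iff f (k.val + 1)).2 (h _ k.isLt)
    have hk : (f k : ℕ × ℕ) ∈ ν := (hν _).2 ⟨k, by omega, rfl⟩
    have hj : (f j : ℕ × ℕ) ∈ ν := ν.isLowerSet hjk hk
    obtain ⟨l, hl, e⟩ := (hν _).1 hj
    have : l = j := f.injective (Subtype.ext e)
    subst this
    exact Fin.le_def.2 (by omega)
  truncation m hm := (exists_shape_iff f m).2 (h m hm)

theorem shapes (t : Tableau r n μ) (m : ℕ) (hm : m ≤ n) : ∃ a b, Shape r t.cell m a b :=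
  (exists_shape_iff t.cell m).1 (t.truncation m hm)

/-- Each entry is placed at the end of the first or of the second row. -/
theorem step (t : Tableau r n μ) (j : Fin n) {a b : ℕ} (h : Shape r t.cell j.val a b) :
    ((t.cell j : ℕ × ℕ) = (0, a) ∧ Shape r t.cell (j.val + 1) (a + 1) b) ∨
    ((t.cell j : ℕ × ℕ) = (1, b) ∧ Shape r t.cell (j.val + 1) a (b + 1)) := by
  obtain ⟨a', b', h'⟩ := t.shapes (j.val + 1) j.isLt
  have split : ∀ c : ℕ × ℕ, (∃ k : Fin n, k.val < j.val + 1 ∧ (t.cell k : ℕ × ℕ) = c) ↔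
      (∃ k : Fin n, k.val < j.val ∧ (t.cell k : ℕ × ℕ) = c) ∨ (t.cell j : ℕ × ℕ) = c := by
    intro c
    constructor
    · rintro ⟨k, hk, e⟩
      rcases Nat.lt_succ_iff_lt_or_eq.1 hk with hk | hk
      · exact Or.inl ⟨k, hk, e⟩
      · have : k = j := Fin.ext hk
        subst this
        exact Or.inr e
    · rintro (⟨k, hk, e⟩ | e)
      · exact ⟨k, by omega, e⟩
      · exact ⟨j, by omega, e⟩
  have hnot : ¬ ∃ k : Fin n, k.val < j.val ∧ (t.cell k : ℕ × ℕ) = t.cell j := by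
    rintro ⟨k, hk, e⟩
    have : k = j := t.cell.injective (Subtype.ext e)
    subst this
    omega
  rw [h.2.2] at hnot
  have key : ∀ x y : ℕ, ((x = 0 ∧ y < a') ∨ (x = 1 ∧ y < b')) ↔
      ((x = 0 ∧ y < a) ∨ (x = 1 ∧ y < b)) ∨ (t.cell j : ℕ × ℕ) = (x, y) := by
    intro x y
    have := split (x, y)
    rw [h.2.2, h'.2.2] at this
    exact this
  generalize (t.cell j : ℕ × ℕ) = p at *
  obtain ⟨x, y⟩ := p
  simp only [Prod.mk.injEq] at *
  have k0 := (key x y).2 (Or.inr ⟨rfl, rfl⟩)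
  rcases k0 with ⟨rfl, hy⟩ | ⟨rfl, hy⟩
  · left
    have hya : y = a := by
      have := key 0 a
      by_contra hne
      have : ¬ a < a' := by
        intro hlt
        have := (key 0 a).1 (Or.inl ⟨rfl, hlt⟩)
        omega
      omega
    subst hya
    have ha : a' = y + 1 := by
      have := key 0 (y + 1)
      omega
    have hb : b' = b := by
      have h1 := key 1 b
      have h2 := key 1 b'
      omega
    subst ha hb
    exact ⟨⟨rfl, rfl⟩, h'⟩
  · right
    have hyb : y = b := by
      have h1 := key 1 b
      omega
    subst hyb
    have hb : b' = y + 1 := by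
      have := key 1 (y + 1)
      omega
    have ha : a' = a := by
      have h1 := key 0 a
      have h2 := key 0 a'
      omega
    subst ha hb
    exact ⟨⟨rfl, rfl⟩, h'⟩

theorem d_bounds (t : Tableau r n μ) (i : Fin (n - 1)) :
    t.d i ≠ 0 ∧ -(r : ℤ) < t.d i ∧ t.d i < r := by
  obtain ⟨a, b, h⟩ := t.shapes i.val (by omega)
  have hs := h.1
  have hs' := h.2.1
  rcases t.step (lo i) h with ⟨e1, h1⟩ | ⟨e1, h1⟩ <;>
    rcases t.step (hi i) h1 with ⟨e2, h2⟩ | ⟨e2, h2⟩ <;>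
    (have g1 := h1.1; have g2 := h1.2.1; have g3 := h2.1; have g4 := h2.2.1
     rw [d, e1, e2]; push_cast; refine ⟨?_, ?_, ?_⟩ <;> omega)

theorem d_three (t : Tableau r n μ) (i j : Fin (n - 1)) (hij : i.val + 1 = j.val) :
    (t.d i = -1 ∧ t.d j ≠ 1 ∧ t.d j ≠ 1 - r) ∨ (t.d j = -1 ∧ t.d i ≠ 1 ∧ t.d i ≠ 1 - r) ∨
      t.d i + t.d j = -1 := by
  obtain ⟨a, b, h⟩ := t.shapes i.val (by omega)
  have hs := h.1
  have hs' := h.2.1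
  have hlo : lo j = hi i := Fin.ext hij.symm
  have hhj : (hi j).val = (hi i).val + 1 := by simp [hi, hij]
  rcases t.step (lo i) h with ⟨e1, h1⟩ | ⟨e1, h1⟩ <;>
    rcases t.step (hi i) h1 with ⟨e2, h2⟩ | ⟨e2, h2⟩ <;>
    rw [← hhj] at h2 <;>
    rcases t.step (hi j) h2 with ⟨e3, h3⟩ | ⟨e3, h3⟩ <;>
    (have g1 := h1.1; have g2 := h1.2.1; have g3 := h2.1; have g4 := h2.2.1
     have g5 := h3.1; have g6 := h3.2.1
     rw [d, d, hlo, e1, e2, e3]; push_cast; omega)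

theorem swapped_shape (t : Tableau r n μ) (i : Fin (n - 1)) {m a b : ℕ} (hm : m ≠ i.val + 1)
    (h : Shape r t.cell m a b) : Shape r (t.swapped i) m a b := by
  refine ⟨h.1, h.2.1, fun c => ?_⟩
  rw [← h.2.2 c]
  have key : ∀ k : Fin n, k.val < m → (Equiv.swap (lo i) (hi i) k).val < m := by
    intro k hk
    rw [Equiv.swap_apply_def]
    split_ifs with h1 h2
    · have := congrArg Fin.val h1
      simp only [lo, hi] at *
      omega
    · have := congrArg Fin.val h2
      simp only [lo, hi] at *
      omega
    · exact hk
  constructor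
  · rintro ⟨k, hk, e⟩
    exact ⟨_, key k hk, e⟩
  · rintro ⟨k, hk, e⟩
    exact ⟨_, key k hk, by simpa [swapped] using e⟩

/-- The exchange gives a tableau unless `d` takes one of three extreme values. -/
theorem exists_swap (t : Tableau r n μ) (i : Fin (n - 1)) (h1 : t.d i ≠ -1) (h2 : t.d i ≠ 1)
    (h3 : t.d i ≠ 1 - r) : ∃ s : Tableau r n μ, s.cell = t.swapped i := by
  suffices H : ∃ a b, Shape r (t.swapped i) (i.val + 1) a b by
    refine ⟨ofShapes (t.swapped i) fun m hm => ?_, rfl⟩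
    by_cases e : m = i.val + 1
    · rw [e]
      exact H
    · obtain ⟨a, b, h⟩ := t.shapes m hm
      exact ⟨a, b, t.swapped_shape i e h⟩
  obtain ⟨a, b, h⟩ := t.shapes i.val (by omega)
  have hs := h.1
  have hs' := h.2.1
  have hsw := t.swapped_shape i (m := i.val) (by omega) h
  have hset : ∀ c : ℕ × ℕ,
      (∃ k : Fin n, k.val < i.val + 1 ∧ (t.swapped i k : ℕ × ℕ) = c) ↔
      ((c.1 = 0 ∧ c.2 < a) ∨ (c.1 = 1 ∧ c.2 < b)) ∨ (t.cell (hi i) : ℕ × ℕ) = c := by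
    intro c
    rw [← hsw.2.2]
    have e : t.swapped i (lo i) = t.cell (hi i) := by simp [swapped]
    constructor
    · rintro ⟨k, hk, e'⟩
      rcases Nat.lt_succ_iff_lt_or_eq.1 hk with hk | hk
      · exact Or.inl ⟨k, hk, e'⟩
      · have : k = lo i := Fin.ext hk
        subst this
        exact Or.inr (by rw [← e, e'])
    · rintro (⟨k, hk, e'⟩ | e')
      · exact ⟨k, by omega, e'⟩
      · exact ⟨lo i, by simp [lo], by rw [e, e']⟩
  rcases t.step (lo i) h with ⟨e1, g1⟩ | ⟨e1, g1⟩ <;>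
    rcases t.step (hi i) g1 with ⟨e2, g2⟩ | ⟨e2, g2⟩ <;>
    (rw [d, e1, e2] at h1 h2 h3; push_cast at h1 h2 h3)
  · omega
  · refine ⟨a, b + 1, by omega, by omega, ?_⟩
    rintro ⟨x, y⟩
    rw [hset, e2]
    simp only [Prod.mk.injEq]
    omega
  · have := g2.2.1
    refine ⟨a + 1, b, by omega, by omega, ?_⟩
    rintro ⟨x, y⟩
    rw [hset, e2]
    simp only [Prod.mk.injEq]
    omega
  · omega

open Classical in
/-- The exchange of `i` and `i+1`, where it is defined. -/
noncomputable def G (i : Fin (n - 1)) (t : Tableau r n μ) : Tableau r n μ :=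
  if h : ∃ s : Tableau r n μ, s.cell = t.swapped i then h.choose else t

theorem G_spec (i : Fin (n - 1)) (t : Tableau r n μ)
    (h : ∃ s : Tableau r n μ, s.cell = t.swapped i) : (G i t).cell = t.swapped i := by
  rw [G, dif_pos h]
  exact h.choose_spec

theorem alpha_eq (t : Tableau r n μ) (i : Fin (n - 1)) : t.alpha i = alphaOf r (t.d i) := rfl

theorem qInt_d (hr : 3 ≤ r) (t : Tableau r n μ) (i : Fin (n - 1)) : qInt r (t.d i) ≠ 0 :=
  qInt_ne_zero hr (t.d_bounds i).1 (t.d_bounds i).2.1 (t.d_bounds i).2.2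

theorem beta_sq (hr : 3 ≤ r) (t : Tableau r n μ) (i : Fin (n - 1)) :
    t.beta i * t.beta i = t.alpha i * (1 - t.alpha i) := by
  rw [beta, Real.mul_self_sqrt]
  rw [alpha_eq]
  exact alphaOf_mul_nonneg hr (t.d_bounds i).1 (t.d_bounds i).2.1 (t.d_bounds i).2.2

theorem extreme (hr : 3 ≤ r) (t : Tableau r n μ) (i : Fin (n - 1))
    (h : ¬ ∃ s : Tableau r n μ, s.cell = t.swapped i) :
    t.d i = -1 ∧ t.alpha i = 0 ∧ t.beta i = 0 ∨
    (t.d i = 1 ∨ t.d i = 1 - r) ∧ t.alpha i = 1 ∧ t.beta i = 0 := by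
  by_cases h1 : t.d i = -1
  · have : t.alpha i = 0 := by rw [alpha_eq, h1, alphaOf_neg_one]
    exact Or.inl ⟨h1, this, by simp [beta, this]⟩
  · have h2 : t.d i = 1 ∨ t.d i = 1 - r := by
      by_contra h2
      push Not at h2
      exact h (t.exists_swap i h1 h2.1 h2.2)
    have : t.alpha i = 1 := by
      rw [alpha_eq]
      rcases h2 with h2 | h2
      · rw [h2, alphaOf_one hr]
      · rw [h2, alphaOf_bot hr]
    exact Or.inr ⟨h2, this, by simp [beta, this]⟩

theorem d_of_swapped {s t : Tableau r n μ} {i : Fin (n - 1)} (h : s.cell = t.swapped i) :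
    s.d i = -t.d i := by
  have h1 : s.cell (lo i) = t.cell (hi i) := by simp [h, swapped]
  have h2 : s.cell (hi i) = t.cell (lo i) := by simp [h, swapped]
  rw [d, d, h1, h2]
  ring

theorem d_of_swapped_far {s t : Tableau r n μ} {i j : Fin (n - 1)} (h : s.cell = t.swapped i)
    (hij : i.val + 1 < j.val ∨ j.val + 1 < i.val) : s.d j = t.d j := by
  have h1 : s.cell (lo j) = t.cell (lo j) := by
    simp only [h, swapped, Equiv.trans_apply]
    rw [Equiv.swap_apply_of_ne_of_ne] <;> simp only [lo, hi, ne_eq, Fin.mk.injEq] <;> omega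
  have h2 : s.cell (hi j) = t.cell (hi j) := by
    simp only [h, swapped, Equiv.trans_apply]
    rw [Equiv.swap_apply_of_ne_of_ne] <;> simp only [lo, hi, ne_eq, Fin.mk.injEq] <;> omega
  rw [d, d, h1, h2]

theorem d_of_swapped_near {s t : Tableau r n μ} {i j : Fin (n - 1)} (h : s.cell = t.swapped i)
    (hij : i.val + 1 = j.val ∨ j.val + 1 = i.val) : s.d j = t.d i + t.d j := by
  rcases hij with hij | hij
  · have e : lo j = hi i := Fin.ext hij.symm
    have h1 : s.cell (lo j) = t.cell (lo i) := by simp [h, swapped, e]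
    have h2 : s.cell (hi j) = t.cell (hi j) := by
      simp only [h, swapped, Equiv.trans_apply]
      rw [Equiv.swap_apply_of_ne_of_ne] <;> simp only [lo, hi, ne_eq, Fin.mk.injEq] <;> omega
    rw [d, d, d, h1, h2, e]
    ring
  · have e : lo i = hi j := Fin.ext hij.symm
    have h1 : s.cell (hi j) = t.cell (hi i) := by simp [h, swapped, e]
    have h2 : s.cell (lo j) = t.cell (lo j) := by
      simp only [h, swapped, Equiv.trans_apply]
      rw [Equiv.swap_apply_of_ne_of_ne] <;> simp only [lo, hi, ne_eq, Fin.mk.injEq] <;> omega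
    rw [d, d, d, h1, h2, e]
    ring

theorem swapped_symm {s t : Tableau r n μ} {i : Fin (n - 1)} (h : s.cell = t.swapped i) :
    t.cell = s.swapped i := by
  apply Equiv.ext
  intro k
  simp [swapped, h]

theorem alpha_of_swapped (hr : 3 ≤ r) {s t : Tableau r n μ} {i : Fin (n - 1)}
    (h : s.cell = t.swapped i) : s.alpha i = 1 - t.alpha i := by
  rw [alpha_eq, d_of_swapped h, alphaOf_neg hr (qInt_d hr t i), alpha_eq]

theorem beta_of_swapped (hr : 3 ≤ r) {s t : Tableau r n μ} {i : Fin (n - 1)}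
    (h : s.cell = t.swapped i) : s.beta i = t.beta i := by
  rw [beta, beta, alpha_of_swapped hr h]
  congr 1
  ring

theorem not_swapped_self (t : Tableau r n μ) (i : Fin (n - 1)) : t.cell ≠ t.swapped i := by
  intro h
  have h1 : t.cell (lo i) = t.cell (hi i) := by
    conv_lhs => rw [h]
    simp [swapped]
  have := congrArg Fin.val (t.cell.injective h1)
  simp [lo, hi] at this

end Tableau

/-! ### The Temperley-Lieb-Jones relations -/

section relations

variable {r n : ℕ} {μ : YoungDiagram}

open Tableau

theorem projector_mulVec (hr : 3 ≤ r) (i : Fin (n - 1)) (f : Tableau r n μ → ℂ)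
    (t : Tableau r n μ) :
    (projector r n μ i).mulVec f t = t.alpha i * f t + t.beta i * f (G i t) := by
  rw [Matrix.mulVec, dotProduct]
  by_cases h : ∃ s : Tableau r n μ, s.cell = t.swapped i
  · have hG := G_spec i t h
    have hne : t ≠ G i t := fun e => not_swapped_self t i (by rw [← hG, ← e])
    rw [Fintype.sum_eq_add t (G i t) hne]
    · simp only [projector, Matrix.of_apply, if_true, if_neg hne, if_pos (swapped_symm hG),
        beta_of_swapped hr hG]
    · rintro s ⟨h1, h2⟩
      have h3 : ¬ t.cell = s.swapped i := fun e =>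
        h2 (Tableau.ext ((swapped_symm e).trans hG.symm))
      simp [projector, h1.symm, h3]
  · have hb : t.beta i = 0 := by rcases extreme hr t i h with h | h <;> exact h.2.2
    rw [Fintype.sum_eq_single t]
    · simp [projector, hb]
    · intro s hs
      have h3 : ¬ t.cell = s.swapped i := fun e => h ⟨s, swapped_symm e⟩
      simp [projector, hs.symm, h3]

theorem beta_mul_projector (hr : 3 ≤ r) (i : Fin (n - 1)) (f : Tableau r n μ → ℂ)
    (t : Tableau r n μ) :
    (t.beta i : ℂ) * (projector r n μ i).mulVec f (G i t) =
      (1 - t.alpha i) * (projector r n μ i).mulVec f t := by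
  rw [projector_mulVec hr, projector_mulVec hr]
  by_cases h : ∃ s : Tableau r n μ, s.cell = t.swapped i
  · have hG := G_spec i t h
    have hGG : G i (G i t) = t := by
      apply Tableau.ext
      rw [G_spec i (G i t) ⟨t, swapped_symm hG⟩, ← swapped_symm hG]
    have hb : (t.beta i : ℂ) * t.beta i = t.alpha i * (1 - t.alpha i) := by
      exact_mod_cast beta_sq hr t i
    rw [hGG, alpha_of_swapped hr hG, beta_of_swapped hr hG]
    push_cast
    linear_combination f t * hb
  · rcases extreme hr t i h with h | h <;> simp [h.2.1, h.2.2]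

theorem projector_mul_self (hr : 3 ≤ r) (i : Fin (n - 1)) :
    projector r n μ i * projector r n μ i = projector r n μ i := by
  apply Matrix.ext_of_mulVec_single
  intro k
  ext t
  rw [← Matrix.mulVec_mulVec, projector_mulVec hr, beta_mul_projector hr]
  ring

theorem projector_comm (hr : 3 ≤ r) (i j : Fin (n - 1))
    (hij : i.val + 1 < j.val ∨ j.val + 1 < i.val) :
    projector r n μ i * projector r n μ j = projector r n μ j * projector r n μ i := by
  apply Matrix.ext_of_mulVec_single
  intro k
  ext t
  generalize (Pi.single k 1 : Tableau r n μ → ℂ) = f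
  rw [← Matrix.mulVec_mulVec, ← Matrix.mulVec_mulVec]
  simp only [projector_mulVec hr]
  by_cases hi' : ∃ s : Tableau r n μ, s.cell = t.swapped i
  · have hGi := G_spec i t hi'
    have dj := d_of_swapped_far hGi hij
    have aj : (G i t).alpha j = t.alpha j := by rw [alpha_eq, dj, alpha_eq]
    have bj : (G i t).beta j = t.beta j := by rw [beta, aj, beta]
    by_cases hj' : ∃ s : Tableau r n μ, s.cell = t.swapped j
    · have hGj := G_spec j t hj'
      have di := d_of_swapped_far hGj hij.symm
      have ai : (G j t).alpha i = t.alpha i := by rw [alpha_eq, di, alpha_eq]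
      have bi : (G j t).beta i = t.beta i := by rw [beta, ai, beta]
      rw [aj, bj, ai, bi]
      by_cases hij' : ∃ s : Tableau r n μ, s.cell = (G i t).swapped j
      · by_cases hji' : ∃ s : Tableau r n μ, s.cell = (G j t).swapped i
        · have e : G j (G i t) = G i (G j t) := by
            apply Tableau.ext
            rw [G_spec j _ hij', G_spec i _ hji', swapped, swapped, hGi, hGj, swapped, swapped]
            apply Equiv.ext
            intro k
            have hc : Equiv.swap (lo i) (hi i) * Equiv.swap (lo j) (hi j) =
                Equiv.swap (lo j) (hi j) * Equiv.swap (lo i) (hi i) := by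
              apply Equiv.Perm.Disjoint.commute
              apply Equiv.Perm.disjoint_swap_swap
              simp only [lo, hi]
              refine List.nodup_cons.2 ⟨?_, ?_⟩ <;> simp <;> omega
            have := congrArg (fun p : Equiv.Perm (Fin n) => t.cell (p k)) hc
            simpa using this
          rw [e]
          ring
        · have hb : t.beta i = 0 := by
            rw [← bi]
            rcases extreme hr _ i hji' with h | h <;> exact h.2.2
          simp [hb]
          ring
      · have hb : t.beta j = 0 := by
          rw [← bj]
          rcases extreme hr _ j hij' with h | h <;> exact h.2.2
        simp [hb]
        ring
    · have hb : t.beta j = 0 := by rcases extreme hr _ j hj' with h | h <;> exact h.2.2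
      rw [aj, bj, hb]
      push_cast
      ring
  · have hb : t.beta i = 0 := by rcases extreme hr _ i hi' with h | h <;> exact h.2.2
    by_cases hj' : ∃ s : Tableau r n μ, s.cell = t.swapped j
    · have hGj := G_spec j t hj'
      have di := d_of_swapped_far hGj hij.symm
      have ai : (G j t).alpha i = t.alpha i := by rw [alpha_eq, di, alpha_eq]
      have bi : (G j t).beta i = t.beta i := by rw [beta, ai, beta]
      rw [ai, bi, hb]
      push_cast
      ring
    · have hb' : t.beta j = 0 := by rcases extreme hr _ j hj' with h | h <;> exact h.2.2
      rw [hb, hb']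
      push_cast
      ring

/-- The entries `i`, `i+1` in one row are killed by the projector. -/
theorem projector_eq_zero (hr : 3 ≤ r) (i : Fin (n - 1)) (f : Tableau r n μ → ℂ)
    (t : Tableau r n μ) (h : t.d i = -1) : (projector r n μ i).mulVec f t = 0 := by
  have ha : t.alpha i = 0 := by rw [alpha_eq, h, alphaOf_neg_one]
  have hb : t.beta i = 0 := by simp [beta, ha]
  rw [projector_mulVec hr, ha, hb]
  simp

theorem projector_inner (hr : 3 ≤ r) (i j : Fin (n - 1))
    (hij : i.val + 1 = j.val ∨ j.val + 1 = i.val) (f : Tableau r n μ → ℂ)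
    (s : Tableau r n μ) (hs : s.d j = -1 ∨ s.d i + s.d j = -1) :
    (projector r n μ j).mulVec ((projector r n μ i).mulVec f) s =
      s.alpha j * (projector r n μ i).mulVec f s := by
  by_cases h1 : s.d j = -1
  · rw [projector_eq_zero hr j _ s h1, alpha_eq, h1, alphaOf_neg_one]
    simp
  · rw [projector_mulVec hr j]
    by_cases h : ∃ u : Tableau r n μ, u.cell = s.swapped j
    · have hG := G_spec j s h
      have : (G j s).d i = -1 := by
        rw [d_of_swapped_near hG hij.symm]
        omega
      rw [projector_eq_zero hr i _ _ this]
      ring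
    · have hb : s.beta j = 0 := by rcases extreme hr _ j h with h | h <;> exact h.2.2
      rw [hb]
      push_cast
      ring

theorem projector_braid (hr : 3 ≤ r) (i j : Fin (n - 1))
    (hij : i.val + 1 = j.val ∨ j.val + 1 = i.val) :
    projector r n μ i * projector r n μ j * projector r n μ i =
      (((qInt r 2 : ℝ) : ℂ) ^ 2)⁻¹ • projector r n μ i := by
  apply Matrix.ext_of_mulVec_single
  intro k
  ext t
  generalize (Pi.single k 1 : Tableau r n μ → ℂ) = f
  rw [← Matrix.mulVec_mulVec, ← Matrix.mulVec_mulVec, Matrix.smul_mulVec, Pi.smul_apply,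
    smul_eq_mul]
  by_cases h0 : t.d i = -1
  · rw [projector_eq_zero hr i _ t h0, projector_eq_zero hr i _ t h0, mul_zero]
  have h3 : (t.d j = -1 ∧ t.d i ≠ 1 ∧ t.d i ≠ 1 - r) ∨ t.d i + t.d j = -1 := by
    rcases hij with hij | hij
    · have := d_three t i j hij
      tauto
    · have := d_three t j i hij
      rw [add_comm] at this
      tauto
  have hbr : (t.alpha i : ℂ) * t.alpha j + (1 - t.alpha i) *
      (if ∃ s : Tableau r n μ, s.cell = t.swapped i then ((G i t).alpha j : ℂ) else 0) =
      (((qInt r 2 : ℝ) : ℂ) ^ 2)⁻¹ := by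
    have hq := qInt_d hr t i
    rcases h3 with ⟨h3, h4, h5⟩ | h3
    · have hex := t.exists_swap i h0 h4 h5
      have hG := G_spec i t hex
      have hd : (G i t).d j = t.d i - 1 := by
        rw [d_of_swapped_near hG hij, h3]
        ring
      have hq' := qInt_d hr (G i t) j
      rw [hd] at hq'
      have := alphaOf_braid_left hr hq hq'
      rw [alphaOf_neg hr hq] at this
      rw [if_pos hex, alpha_eq, alpha_eq, alpha_eq, hd, h3, alphaOf_neg_one]
      have h' := congrArg (fun x : ℝ => (x : ℂ)) this
      push_cast at h'
      rw [← h']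
      push_cast
      ring
    · have hj : t.d j = -1 - t.d i := by omega
      have hq' := qInt_d hr t j
      rw [hj, show -1 - t.d i = -(t.d i + 1) by ring, qInt_neg] at hq'
      have := alphaOf_braid_right hr hq (neg_ne_zero.1 hq')
      have h' := congrArg (fun x : ℝ => (x : ℂ)) this
      push_cast at h'
      rw [← h', alpha_eq t j, hj, alpha_eq]
      split_ifs with hex
      · have hG := G_spec i t hex
        rw [alpha_eq, d_of_swapped_near hG hij, h3, alphaOf_neg_one]
        push_cast
        ring
      · ring
  rw [projector_mulVec hr i, projector_inner hr i j hij f t (by tauto), ← hbr]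
  by_cases hex : ∃ s : Tableau r n μ, s.cell = t.swapped i
  · have hG := G_spec i t hex
    have d1 := d_of_swapped hG
    have d2 := d_of_swapped_near hG hij
    rw [projector_inner hr i j hij f (G i t) (by omega), if_pos hex]
    have := beta_mul_projector hr i f t
    linear_combination ((G i t).alpha j : ℂ) * this
  · have hb : t.beta i = 0 := by rcases extreme hr _ i hex with h | h <;> exact h.2.2
    rw [hb, if_neg hex]
    push_cast
    ring

theorem projector_star (hr : 3 ≤ r) (i : Fin (n - 1)) :
    star (projector r n μ i) = projector r n μ i := by
  ext s t
  rw [Matrix.star_apply]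
  simp only [projector, Matrix.of_apply]
  by_cases h : s = t
  · simp [h]
  · rw [if_neg h, if_neg (Ne.symm h)]
    by_cases h' : s.cell = t.swapped i
    · rw [if_pos h', if_pos (swapped_symm h'), beta_of_swapped hr h']
      simp
    · rw [if_neg h', if_neg fun e => h' (swapped_symm e)]
      simp

theorem sigmaMatrix_mem (hr : 3 ≤ r) (i : Fin (n - 1)) :
    sigmaMatrix r n μ i ∈ Matrix.unitaryGroup (Tableau r n μ) ℂ := by
  rw [Matrix.mem_unitaryGroup_iff, sigmaMatrix, star_sub, star_smul, star_smul, star_one,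
    projector_star hr]
  have hq := norm_q r
  have hp := projector_mul_self (μ := μ) hr i
  simp only [sub_mul, mul_sub, smul_mul_assoc, mul_smul_comm, one_mul, mul_one, hp]
  rw [star_add, star_one]
  match_scalars
  · linear_combination hq
  · linear_combination -hq

theorem sigmaMatrix_comm (hr : 3 ≤ r) (i j : Fin (n - 1))
    (hij : i.val + 1 < j.val ∨ j.val + 1 < i.val) :
    sigmaMatrix r n μ i * sigmaMatrix r n μ j = sigmaMatrix r n μ j * sigmaMatrix r n μ i := by
  have h := projector_comm (μ := μ) hr i j hij
  simp only [sigmaMatrix, sub_mul, mul_sub, smul_mul_assoc, mul_smul_comm, one_mul, mul_one, h]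
  module

theorem sigmaMatrix_braid (hr : 3 ≤ r) (i j : Fin (n - 1))
    (hij : i.val + 1 = j.val ∨ j.val + 1 = i.val) :
    sigmaMatrix r n μ i * sigmaMatrix r n μ j * sigmaMatrix r n μ i =
      sigmaMatrix r n μ j * sigmaMatrix r n μ i * sigmaMatrix r n μ j := by
  have h1 := projector_braid (μ := μ) hr i j hij
  have h2 := projector_braid (μ := μ) hr j i hij.symm
  have p1 := projector_mul_self (μ := μ) hr i
  have p2 := projector_mul_self (μ := μ) hr j
  have h2q : ((qInt r 2 : ℝ) : ℂ) ≠ 0 := by exact_mod_cast two_ne hr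
  have hc : (1 + q r) ^ 2 * (((qInt r 2 : ℝ) : ℂ) ^ 2)⁻¹ = q r := by
    rw [q_qInt hr]
    field_simp
  simp only [sigmaMatrix, sub_mul, mul_sub, smul_mul_assoc, mul_smul_comm, one_mul, mul_one,
    smul_smul, h1, h2, p1, p2, smul_sub]
  match_scalars
  all_goals first
    | ring1
    | linear_combination (1 + q r) * hc
    | linear_combination (-(1 + q r)) * hc

end relations

/-! ### The sectors -/

/-- The images of the generators as unitary matrices. -/
noncomputable def sigmaUnitary (r n : ℕ) (hr : 3 ≤ r) (μ : YoungDiagram) (i : Fin (n - 1)) :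
    Matrix.unitaryGroup (Tableau r n μ) ℂ :=
  ⟨sigmaMatrix r n μ i, sigmaMatrix_mem hr i⟩

theorem sigmaUnitary_rels (r n : ℕ) (hr : 3 ≤ r) (μ : YoungDiagram) :
    ∀ w ∈ braidRels n, FreeGroup.lift (sigmaUnitary r n hr μ) w = 1 := by
  rintro w (⟨i, j, hij, rfl⟩ | ⟨i, j, hij, rfl⟩)
  · simp only [map_mul, map_inv, FreeGroup.lift_apply_of]
    rw [mul_inv_eq_one, mul_inv_eq_iff_eq_mul]
    exact Subtype.ext (sigmaMatrix_comm hr i j hij)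
  · simp only [map_mul, map_inv, FreeGroup.lift_apply_of]
    rw [mul_inv_eq_one]
    exact Subtype.ext (sigmaMatrix_braid hr i j hij)

/-- The sector `ρ_{λ,β,n} : B_n → U(V_λ)` of the Jones representation at `q = e^{2πi/r}`, in the
orthonormal basis `v_t`: it sends `σ_i` to `q - (1 + q) e_i`. -/
noncomputable def sector (r n : ℕ) (hr : 3 ≤ r) (μ : YoungDiagram) :
    BraidGroup n →* Matrix.unitaryGroup (Tableau r n μ) ℂ :=
  PresentedGroup.toGroup (sigmaUnitary_rels r n hr μ)

/-- The sector as a linear representation on the space `V_λ` of functions on the tableaux. -/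
noncomputable def sectorRep (r n : ℕ) (hr : 3 ≤ r) (μ : YoungDiagram) :
    Representation ℂ (BraidGroup n) (Tableau r n μ → ℂ) :=
  (MonoidHomClass.toMonoidHom
    (Matrix.toLinAlgEquiv' : Matrix (Tableau r n μ) (Tableau r n μ) ℂ ≃ₐ[ℂ] _)).comp
    ((Matrix.unitaryGroup (Tableau r n μ) ℂ).subtype.comp (sector r n hr μ))

/-- The subgroup of `U(V_λ)` generated by the images of the first two generators `σ_1`, `σ_2`. -/
noncomputable def firstTwo (r n : ℕ) (hr : 3 ≤ r) (hn : 3 ≤ n) (μ : YoungDiagram) :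
    Subgroup (Matrix.unitaryGroup (Tableau r n μ) ℂ) :=
  Subgroup.closure {sector r n hr μ (BraidGroup.σ ⟨0, by omega⟩),
    sector r n hr μ (BraidGroup.σ ⟨1, by omega⟩)}

/-- The Young diagram `[4, 2]`. -/
def diagram42 : YoungDiagram :=
  YoungDiagram.ofRowLens [4, 2] (by simp [List.sortedGE_iff_pairwise])

end JonesSector

/-!
Irreducibility: an invariant subspace is stable under the Jucys-Murphy elements, which are diagonal
in the basis `v_t` with entries `q ^ content`.  The `(2,r)`-condition keeps the contents that have
to be compared less than `r` apart, so these operators separate the tableaux and every nonzero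
invariant subspace contains some `v_t`.  Any two tableaux are connected by exchanges of consecutive
entries, along which the coefficient `β_{t,i}` does not vanish.

Infinite image: on the span of `e₁` and `e₂ e₁` the element `σ₁ σ₂⁻¹` acts with eigenvalues `x` and
`x⁻¹` satisfying `x + x⁻¹ = 1 - q - q⁻¹`.  If one of its powers commuted with `σ₁`, then `x` would
be a root of unity, and so would all its Galois conjugates.  For `r ≠ 3, 4, 6, 10` there is a
primitive `r`-th root of unity with real part less than `-1/2`, and the corresponding conjugate `y`
would have `Re (y + y⁻¹) > 2`.

Multiplicities: the eigenspace for `-1` is the range of `e_i`.  The Temperley-Lieb relations make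
all `e_i` have the same trace, and `e₁` is diagonal with entry `1` exactly at the tableaux with the
entry `2` in the second row.
-/

namespace JonesSector

/-! ### Temperley–Lieb pairs of idempotents -/

section TemperleyLieb

/-- The element `a - (1 + a) e`, which represents a braid generator when `e` is a Temperley–Lieb
idempotent.  For an idempotent `e` it acts as `-1` on the range of `e` and as `a` on the kernel. -/
def hecke {R A : Type*} [CommRing R] [Ring A] [Algebra R A] (a : R) (e : A) : A :=
  a • 1 - (1 + a) • e

/-- Two idempotents subject to the Temperley–Lieb relations with parameter `τ = 1 / β`. -/
structure IsTemperleyLiebPair {R A : Type*} [CommRing R] [Ring A] [Algebra R A]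
    (τ : R) (E F : A) : Prop where
  idem_left : IsIdempotentElem E
  idem_right : IsIdempotentElem F
  left_right_left : E * F * E = τ • E
  right_left_right : F * E * F = τ • F

section Ring

variable {R A : Type*} [CommRing R] [Ring A] [Algebra R A]

theorem hecke_mul (a : R) (e x : A) : hecke a e * x = a • x - (1 + a) • (e * x) := by
  rw [hecke, sub_mul, smul_mul_assoc, smul_mul_assoc, one_mul]

theorem smul_pow_succ_mul {x y : R} (hxy : x * y = 1) {g e : A}
    (hg : g * (g * e) = (x + y) • (g * e) - e) (n : ℕ) :
    (x - y) • (g ^ (n + 1) * e) =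
      (x ^ (n + 1) - y ^ (n + 1)) • (g * e) - (x ^ n - y ^ n) • e := by
  induction n with
  | zero => simp
  | succ n ih =>
    calc (x - y) • (g ^ (n + 2) * e) = g * ((x - y) • (g ^ (n + 1) * e)) := by
          rw [mul_smul_comm, ← mul_assoc, ← pow_succ']
      _ = (x ^ (n + 1) - y ^ (n + 1)) • ((x + y) • (g * e) - e) - (x ^ n - y ^ n) • (g * e) := by
          rw [ih, mul_sub, mul_smul_comm, mul_smul_comm, hg]
      _ = (x ^ (n + 2) - y ^ (n + 2)) • (g * e) - (x ^ (n + 1) - y ^ (n + 1)) • e := by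
          rw [smul_sub, smul_smul, sub_right_comm, ← sub_smul]
          congr 2
          linear_combination (x ^ n - y ^ n) * hxy

end Ring

namespace IsTemperleyLiebPair

section Ring

variable {R A : Type*} [CommRing R] [Ring A] [Algebra R A] {τ : R} {E F : A}

theorem symm (h : IsTemperleyLiebPair τ E F) : IsTemperleyLiebPair τ F E :=
  ⟨h.idem_right, h.idem_left, h.right_left_right, h.left_right_left⟩

variable {a b : R}

theorem hecke_mul_hecke_mul_left (h : IsTemperleyLiebPair τ E F) (hab : a * b = 1)
    (hτ : (1 + a) ^ 2 * τ = a) :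
    hecke a E * hecke b F * E = (1 - b) • E - (1 + a) • (F * E) := by
  have hE : E * (F * E) = τ • E := by rw [← mul_assoc, h.left_right_left]
  rw [mul_assoc, hecke_mul b, hecke_mul, mul_sub, mul_smul_comm, mul_smul_comm, h.idem_left.eq, hE]
  match_scalars
  · linear_combination (1 - (1 + a) * τ) * hab + b * hτ
  · linear_combination -hab

theorem hecke_mul_hecke_mul_right_mul_left (h : IsTemperleyLiebPair τ E F) :
    hecke a E * hecke b F * (F * E) = ((1 + a) * τ) • E - a • (F * E) := by
  have hE : E * (F * E) = τ • E := by rw [← mul_assoc, h.left_right_left]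
  have hF : F * (F * E) = F * E := by rw [← mul_assoc, h.idem_right.eq]
  rw [mul_assoc, hecke_mul b, hF, hecke_mul, mul_sub, mul_smul_comm, mul_smul_comm, hE]
  module

theorem hecke_mul_hecke_sq_mul_left (h : IsTemperleyLiebPair τ E F) (hab : a * b = 1)
    (hτ : (1 + a) ^ 2 * τ = a) :
    hecke a E * hecke b F * (hecke a E * hecke b F * E) =
      (1 - a - b) • (hecke a E * hecke b F * E) - E := by
  simp only [h.hecke_mul_hecke_mul_left hab hτ, mul_sub, mul_smul_comm,
    h.hecke_mul_hecke_mul_right_mul_left]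
  match_scalars
  · linear_combination -hτ - hab
  · ring

end Ring

section Field

variable {K A : Type*} [Field K] [Ring A] [Algebra K A] {τ : K} {E F : A}

theorem left_ne_zero_of_right_ne_zero (h : IsTemperleyLiebPair τ E F) (hτ : τ ≠ 0) (hF : F ≠ 0) :
    E ≠ 0 := by
  rintro rfl
  have h0 : τ • F = 0 := by rw [← h.right_left_right, mul_zero, zero_mul]
  exact (smul_ne_zero hτ hF) h0

theorem left_ne_zero_iff (h : IsTemperleyLiebPair τ E F) (hτ : τ ≠ 0) : E ≠ 0 ↔ F ≠ 0 :=
  ⟨h.symm.left_ne_zero_of_right_ne_zero hτ, h.left_ne_zero_of_right_ne_zero hτ⟩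

theorem left_ne_one (h : IsTemperleyLiebPair τ E F) (hτ : τ ≠ 1) (hF : F ≠ 0) : E ≠ 1 := by
  rintro rfl
  have h0 : (1 - τ) • F = 0 := by
    rw [sub_smul, one_smul, ← h.right_left_right, mul_one, h.idem_right.eq, sub_self]
  exact smul_ne_zero (sub_ne_zero.2 hτ.symm) hF h0

theorem right_mul_left_ne (h : IsTemperleyLiebPair τ E F) (hτ0 : τ ≠ 0) (hτ1 : τ ≠ 1)
    (hE : E ≠ 0) : F * E ≠ τ • E := by
  intro hFE
  have h0 : (1 - τ) • (F * E) = 0 := by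
    rw [sub_smul, one_smul, ← mul_smul_comm, ← hFE, ← mul_assoc, h.idem_right.eq, sub_self]
  rw [smul_eq_zero_iff_right (sub_ne_zero.2 hτ1.symm), hFE] at h0
  exact smul_ne_zero hτ0 hE h0

/-- Comparing `g ^ n * E` with `E * g ^ n * E` for `g = hecke a E * hecke b F` isolates the
component `x ^ n - x⁻¹ ^ n` of `g ^ n` off the diagonal, where `x` and `x⁻¹` are the eigenvalues
of `g` on the two-dimensional space spanned by `E` and `F * E`. -/
theorem pow_two_mul_eq_one_of_commute (h : IsTemperleyLiebPair τ E F) {a b x y : K}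
    (hab : a * b = 1) (ha : 1 + a ≠ 0) (hτ : (1 + a) ^ 2 * τ = a) (hτ0 : τ ≠ 0) (hτ1 : τ ≠ 1)
    (hE : E ≠ 0) (hxy : x * y = 1) (hsum : x + y = 1 - a - b) {n : ℕ}
    (hcomm : Commute ((hecke a E * hecke b F) ^ n) E) : x ^ (2 * n) = 1 := by
  rcases n with - | n
  · simp
  set g := hecke a E * hecke b F with hg
  have hpow := smul_pow_succ_mul hxy (g := g) (e := E)
    (by rw [hsum]; exact h.hecke_mul_hecke_sq_mul_left hab hτ) n
  have hdiag : g ^ (n + 1) * E - E * (g ^ (n + 1) * E) = 0 := by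
    rw [hcomm.eq, ← mul_assoc, h.idem_left.eq, sub_self]
  have hoff : g * E - E * (g * E) = -(1 + a) • (F * E - τ • E) := by
    rw [hg, h.hecke_mul_hecke_mul_left hab hτ, mul_sub, mul_smul_comm, mul_smul_comm,
      h.idem_left.eq, ← mul_assoc, h.left_right_left]
    module
  have hzero : (x ^ (n + 1) - y ^ (n + 1)) • (-(1 + a) • (F * E - τ • E)) = 0 := by
    rw [← hoff]
    calc _ = (x - y) • (g ^ (n + 1) * E) - E * ((x - y) • (g ^ (n + 1) * E)) := by
          rw [hpow, mul_sub, mul_smul_comm, mul_smul_comm, h.idem_left.eq]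
          module
      _ = 0 := by rw [mul_smul_comm, ← smul_sub, hdiag, smul_zero]
  have hne : -(1 + a) • (F * E - τ • E) ≠ 0 :=
    smul_ne_zero (neg_ne_zero.2 ha) (sub_ne_zero.2 (h.right_mul_left_ne hτ0 hτ1 hE))
  have hx : x ^ (n + 1) = y ^ (n + 1) := sub_eq_zero.1 ((smul_eq_zero_iff_left hne).1 hzero)
  rw [two_mul, pow_add]
  nth_rewrite 2 [hx]
  rw [← mul_pow, hxy, one_pow]

theorem trace_eq {ι : Type*} [Fintype ι] [DecidableEq ι] {E F : Matrix ι ι K}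
    (h : IsTemperleyLiebPair τ E F) (hτ : τ ≠ 0) : E.trace = F.trace := by
  have hEF : (E * F).trace = τ * E.trace := by
    rw [← smul_eq_mul τ, ← Matrix.trace_smul, ← h.left_right_left,
      Matrix.trace_mul_comm (E * F), ← mul_assoc, h.idem_left.eq]
  have hFE : (E * F).trace = τ * F.trace := by
    rw [← smul_eq_mul τ, ← Matrix.trace_smul, ← h.right_left_right, mul_assoc,
      Matrix.trace_mul_comm F, mul_assoc, h.idem_right.eq]
  exact mul_left_cancel₀ hτ (hEF.symm.trans hFE)

end Field

end IsTemperleyLiebPair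

theorem commute_hecke_iff {K A : Type*} [Field K] [Ring A] [Algebra K A] {a : K} (ha : 1 + a ≠ 0)
    {e g : A} : Commute g (hecke a e) ↔ Commute g e := by
  refine ⟨fun h => ?_, fun h => ?_⟩
  · have hs : e = (1 + a)⁻¹ • (a • 1 - hecke a e) := by
      rw [hecke, sub_sub_cancel, inv_smul_smul₀ ha]
    rw [hs]
    exact (((Commute.one_right g).smul_right a).sub_right h).smul_right _
  · exact ((Commute.one_right g).smul_right a).sub_right (h.smul_right _)

section Eigenvalues

variable {K V : Type*} [Field K] [AddCommGroup V] [Module K V] {a : K} {E : Module.End K V}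

theorem hecke_apply (a : K) (E : Module.End K V) (v : V) :
    hecke a E v = a • v - (1 + a) • E v := by
  simp only [hecke, LinearMap.sub_apply, LinearMap.smul_apply, Module.End.one_apply]

theorem eq_of_hasEigenvalue_hecke (hE : IsIdempotentElem E) {z : K}
    (hz : Module.End.HasEigenvalue (hecke a E) z) : z = -1 ∨ z = a := by
  obtain ⟨v, hv⟩ := hz.exists_hasEigenvector
  have hEv : (1 + a) • E v = (a - z) • v := by
    have := hv.apply_eq_smul
    rw [hecke_apply] at this
    rw [sub_smul, ← this, sub_sub_cancel]
  have hEE : E (E v) = E v := LinearMap.congr_fun hE v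
  have h0 : ((z + 1) * (z - a)) • v = 0 := by
    have h : (1 + a) • (a - z) • v = (a - z) • (a - z) • v :=
      calc (1 + a) • (a - z) • v = (1 + a) • E ((1 + a) • E v) := by
            rw [map_smul, hEE, hEv]
        _ = (a - z) • (a - z) • v := by rw [hEv, map_smul, smul_comm, hEv]
    rw [← sub_eq_zero] at h
    rw [← neg_eq_zero, ← h]
    module
  rcases mul_eq_zero.1 ((smul_eq_zero_iff_left hv.2).1 h0) with h | h
  · exact Or.inl (eq_neg_of_add_eq_zero_left h)
  · exact Or.inr (sub_eq_zero.1 h)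

theorem eigenspace_hecke_neg_one (ha : 1 + a ≠ 0) (hE : IsIdempotentElem E) :
    Module.End.eigenspace (hecke a E) (-1) = LinearMap.range E := by
  ext v
  rw [Module.End.mem_eigenspace_iff, LinearMap.IsIdempotentElem.mem_range_iff hE, hecke_apply,
    ← sub_eq_zero, show a • v - (1 + a) • E v - (-1 : K) • v = (1 + a) • (v - E v) by module,
    smul_eq_zero_iff_right ha, sub_eq_zero, eq_comm]

theorem eigenspace_hecke_self (ha : 1 + a ≠ 0) :
    Module.End.eigenspace (hecke a E) a = LinearMap.ker E := by
  ext v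
  rw [Module.End.mem_eigenspace_iff, LinearMap.mem_ker, hecke_apply, sub_eq_self,
    smul_eq_zero_iff_right ha]

theorem hasEigenvalue_hecke_neg_one_iff (ha : 1 + a ≠ 0) (hE : IsIdempotentElem E) :
    Module.End.HasEigenvalue (hecke a E) (-1) ↔ E ≠ 0 := by
  rw [Module.End.hasEigenvalue_iff, eigenspace_hecke_neg_one ha hE, ne_eq, LinearMap.range_eq_bot]

theorem hasEigenvalue_hecke_self_iff (ha : 1 + a ≠ 0) (hE : IsIdempotentElem E) :
    Module.End.HasEigenvalue (hecke a E) a ↔ E ≠ 1 := by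
  rw [Module.End.hasEigenvalue_iff, eigenspace_hecke_self ha, ne_eq, not_iff_not,
    LinearMap.IsIdempotentElem.ker_eq_range_one_sub hE, LinearMap.range_eq_bot, sub_eq_zero,
    eq_comm]

theorem hasEigenvalue_hecke_iff (ha : 1 + a ≠ 0) (hE : IsIdempotentElem E) (h0 : E ≠ 0)
    (h1 : E ≠ 1) (z : K) : Module.End.HasEigenvalue (hecke a E) z ↔ z = -1 ∨ z = a := by
  refine ⟨eq_of_hasEigenvalue_hecke hE, ?_⟩
  rintro (rfl | rfl)
  · exact (hasEigenvalue_hecke_neg_one_iff ha hE).2 h0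
  · exact (hasEigenvalue_hecke_self_iff ha hE).2 h1

theorem finrank_eigenspace_hecke_neg_one [FiniteDimensional K V] (ha : 1 + a ≠ 0)
    (hE : IsIdempotentElem E) :
    (Module.finrank K (Module.End.eigenspace (hecke a E) (-1)) : K) = LinearMap.trace K V E := by
  rw [eigenspace_hecke_neg_one ha hE, LinearMap.IsProj.trace
    (LinearMap.IsIdempotentElem.isProj_range E hE)]

theorem finrank_eigenspace_hecke_add [FiniteDimensional K V] (ha : 1 + a ≠ 0)
    (hE : IsIdempotentElem E) :
    Module.finrank K (Module.End.eigenspace (hecke a E) (-1)) +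
      Module.finrank K (Module.End.eigenspace (hecke a E) a) = Module.finrank K V := by
  rw [eigenspace_hecke_neg_one ha hE, eigenspace_hecke_self ha,
    LinearMap.finrank_range_add_finrank_ker]

end Eigenvalues

end TemperleyLieb

/-! ### Groups infinite modulo the centre, and invariant subspaces of function spaces -/

section Center

variable {G : Type*} [Group G] {g h : G}

theorem not_isOfFinOrder_mk_center (hgh : ∀ n, 0 < n → ¬ Commute (g ^ n) h) :
    ¬ IsOfFinOrder (QuotientGroup.mk' (Subgroup.center G) g) := by
  rw [isOfFinOrder_iff_pow_eq_one]
  rintro ⟨n, hn, hpow⟩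
  rw [← map_pow, QuotientGroup.mk'_apply, QuotientGroup.eq_one_iff, Subgroup.mem_center_iff] at hpow
  exact hgh n hn (hpow h).symm

theorem infinite_map_mk_center {H : Subgroup G} (hg : g ∈ H)
    (hgh : ∀ n, 0 < n → ¬ Commute (g ^ n) h) :
    Infinite (H.map (QuotientGroup.mk' (Subgroup.center G))) := by
  rw [← not_finite_iff_infinite]
  intro hfin
  exact not_isOfFinOrder_mk_center hgh (Submonoid.isOfFinOrder_coe.2 (isOfFinOrder_of_finite
    (⟨_, Subgroup.mem_map_of_mem _ hg⟩ : H.map (QuotientGroup.mk' (Subgroup.center G)))))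

theorem infinite_quotient_center (hgh : ∀ n, 0 < n → ¬ Commute (g ^ n) h) :
    Infinite (G ⧸ Subgroup.center G) := by
  rw [← not_finite_iff_infinite]
  exact fun hfin => not_isOfFinOrder_mk_center hgh (isOfFinOrder_of_finite _)

end Center

/-- Multiplying by `(c k · - c k s) / (c k t - c k s)` for a `k` separating `s` from `t` erases the
value at `s` and keeps the one at `t`. -/
theorem single_mem_of_mul_mem {K ι κ : Type*} [Field K] [Finite ι] [DecidableEq ι]
    {W : Submodule K (ι → K)} (c : κ → ι → K) (hW : ∀ k, ∀ f ∈ W, c k * f ∈ W)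
    (hc : ∀ s t, s ≠ t → ∃ k, c k s ≠ c k t) {f : ι → K} (hf : f ∈ W) {t : ι} (ht : f t ≠ 0) :
    Pi.single t 1 ∈ W := by
  have := Fintype.ofFinite ι
  have herase (S : Finset ι) : t ∉ S → ∃ g ∈ W, g t = 1 ∧ ∀ s ∈ S, g s = 0 := by
    induction S using Finset.induction with
    | empty =>
      exact fun _ => ⟨(f t)⁻¹ • f, W.smul_mem _ hf, inv_mul_cancel₀ ht, by simp⟩
    | insert s S _ ih =>
      intro htS
      rw [Finset.mem_insert, not_or] at htS
      obtain ⟨g, hg, hgt, hgS⟩ := ih htS.2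
      obtain ⟨k, hk⟩ := hc t s htS.1
      refine ⟨(c k t - c k s)⁻¹ • (c k * g - c k s • g),
        W.smul_mem _ (W.sub_mem (hW k g hg) (W.smul_mem _ hg)), ?_, fun u hu => ?_⟩
      · simp [hgt, inv_mul_cancel₀ (sub_ne_zero.2 hk)]
      · rcases Finset.mem_insert.1 hu with rfl | hu
        · simp
        · simp [hgS u hu]
  obtain ⟨g, hg, hgt, hg0⟩ := herase (Finset.univ.erase t) (Finset.notMem_erase t _)
  convert hg using 1
  ext s
  by_cases hst : s = t
  · simp [hst, hgt]
  · simp [hst, hg0]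

theorem eq_of_forall_succ_eq {α : Type*} {m : ℕ} {f : Fin m → α}
    (h : ∀ i j : Fin m, i.val + 1 = j.val → f i = f j) (i j : Fin m) : f i = f j := by
  have hzero (k : ℕ) (hk : k < m) : f ⟨0, by omega⟩ = f ⟨k, hk⟩ := by
    induction k with
    | zero => rfl
    | succ k ih => exact (ih (by omega)).trans (h _ _ rfl)
  exact (hzero i i.isLt).symm.trans (hzero j j.isLt)

/-! ### Tableaux as row words -/

section RowWords

/-- The number of letters `true` among the first `m` letters of `w`.  In the row word of a tableau,
where `true` stands for the second row, it is the length of the second row after `m` entries. -/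
def secondCount (w : ℕ → Bool) (m : ℕ) : ℕ := Nat.count (fun j => w j = true) m

/-- The words of `n` letters whose prefixes describe `(2,r)`-diagrams, and which contain `b` letters
`true`.  Only the first `n` letters of `w` matter. -/
def IsAdmissible (r n b : ℕ) (w : ℕ → Bool) : Prop :=
  (∀ m ≤ n, 2 * secondCount w m ≤ m ∧ m + 2 ≤ 2 * secondCount w m + r) ∧ secondCount w n = b

/-- The cell of the entry `j` in the filling with row word `w`; the subtraction does not
truncate. -/
def wordCell (w : ℕ → Bool) (j : ℕ) : ℕ × ℕ :=
  if w j then (1, secondCount w j) else (0, j - secondCount w j)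

theorem secondCount_zero (w : ℕ → Bool) : secondCount w 0 = 0 := Nat.count_zero _

theorem secondCount_succ (w : ℕ → Bool) (m : ℕ) :
    secondCount w (m + 1) = secondCount w m + if w m then 1 else 0 := Nat.count_succ _ _

theorem secondCount_le (w : ℕ → Bool) (m : ℕ) : secondCount w m ≤ m := Nat.count_le _

theorem secondCount_congr {v w : ℕ → Bool} {m : ℕ} (h : ∀ j < m, v j = w j) :
    secondCount v m = secondCount w m := by
  induction m with
  | zero => rfl
  | succ m ih =>
    rw [secondCount_succ, secondCount_succ, ih fun j hj => h j (by omega), h m (by omega)]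

theorem exists_wordCell_iff (w : ℕ → Bool) (m : ℕ) (c : ℕ × ℕ) :
    (∃ j < m, wordCell w j = c) ↔ (c.1 = 0 ∧ c.2 < m - secondCount w m) ∨
      (c.1 = 1 ∧ c.2 < secondCount w m) := by
  obtain ⟨x, y⟩ := c
  induction m with
  | zero => simp [secondCount_zero]
  | succ m ih =>
    have hle := secondCount_le w m
    rw [Nat.exists_lt_succ_right, ih, wordCell, secondCount_succ]
    cases w m <;> simp only [Bool.false_eq_true, if_false, if_true, Prod.mk.injEq] <;> omega

theorem mem_cells_iff_of_colLen_le {μ : YoungDiagram} (hμ : μ.colLen 0 ≤ 2) (c : ℕ × ℕ) :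
    c ∈ μ.cells ↔ (c.1 = 0 ∧ c.2 < μ.rowLen 0) ∨ (c.1 = 1 ∧ c.2 < μ.rowLen 1) := by
  obtain ⟨x, y⟩ := c
  rw [YoungDiagram.mem_cells, YoungDiagram.mem_iff_lt_rowLen]
  rcases Nat.lt_or_ge x 2 with hx | hx
  · interval_cases x <;> simp
  · have hrow : μ.rowLen x = 0 := by
      by_contra h
      have hmem : (x, 0) ∈ μ := YoungDiagram.mem_iff_lt_rowLen.2 (Nat.pos_of_ne_zero h)
      rw [YoungDiagram.mem_iff_lt_colLen] at hmem
      omega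
    simp only [hrow]
    omega

theorem card_eq_of_colLen_le {μ : YoungDiagram} (hμ : μ.colLen 0 ≤ 2) :
    μ.card = μ.rowLen 0 + μ.rowLen 1 := by
  have hcells : μ.cells = μ.row 0 ∪ μ.row 1 := by
    ext c
    rw [Finset.mem_union, YoungDiagram.mem_row_iff, YoungDiagram.mem_row_iff,
      ← YoungDiagram.mem_cells, ← and_or_left, iff_self_and, mem_cells_iff_of_colLen_le hμ]
    exact Or.imp And.left And.left
  have hdisj : Disjoint (μ.row 0) (μ.row 1) := by
    refine Finset.disjoint_left.2 fun c h0 h1 => ?_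
    rw [YoungDiagram.mem_row_iff] at h0 h1
    exact zero_ne_one (h0.2.symm.trans h1.2)
  rw [YoungDiagram.card, hcells, Finset.card_union_of_disjoint hdisj,
    ← YoungDiagram.rowLen_eq_card, ← YoungDiagram.rowLen_eq_card]

namespace Tableau

variable {r n : ℕ} {μ : YoungDiagram}

/-- The row word of a tableau: whether the entry `j` sits in the second row, with the value `false`
if there is no such entry. -/
def rowWord (t : Tableau r n μ) (j : ℕ) : Bool :=
  if h : j < n then decide ((t.cell ⟨j, h⟩ : ℕ × ℕ).1 = 1) else false

theorem rowWord_coe (t : Tableau r n μ) (j : Fin n) :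
    t.rowWord j = decide ((t.cell j : ℕ × ℕ).1 = 1) := by rw [rowWord, dif_pos j.isLt]

theorem shape_secondCount (t : Tableau r n μ) {m : ℕ} (hm : m ≤ n) :
    Shape r t.cell m (m - secondCount t.rowWord m) (secondCount t.rowWord m) := by
  induction m with
  | zero =>
    obtain ⟨a, b, h⟩ := t.shapes 0 hm
    have ha : a = 0 := by
      by_contra ha
      obtain ⟨j, hj, -⟩ := (h.2.2 (0, 0)).2 (Or.inl ⟨rfl, by omega⟩)
      omega
    have hb : b = 0 := Nat.le_zero.1 (ha ▸ h.1)
    subst ha hb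
    simpa only [secondCount_zero] using h
  | succ m ih =>
    have h := ih (by omega)
    have hle := secondCount_le t.rowWord m
    have hw := t.rowWord_coe ⟨m, hm⟩
    rw [secondCount_succ]
    rcases t.step ⟨m, hm⟩ h with ⟨hcell, hnext⟩ | ⟨hcell, hnext⟩
    · simp only [show t.rowWord m = false by simpa [hcell] using hw, Bool.false_eq_true, if_false,
        add_zero]
      convert hnext using 1
      exact Nat.sub_add_comm hle
    · simp only [show t.rowWord m = true by simpa [hcell] using hw, if_true]
      convert hnext using 1
      exact Nat.add_sub_add_right m 1 _

theorem cell_eq_wordCell (t : Tableau r n μ) (j : Fin n) :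
    (t.cell j : ℕ × ℕ) = wordCell t.rowWord j := by
  rw [wordCell, t.rowWord_coe]
  rcases t.step j (t.shape_secondCount j.isLt.le) with ⟨hcell, -⟩ | ⟨hcell, -⟩ <;> simp [hcell]

theorem secondCount_rowWord (t : Tableau r n μ) : secondCount t.rowWord n = μ.rowLen 1 := by
  have hshape := (t.shape_secondCount le_rfl).2.2
  refine eq_of_forall_lt_iff fun y => ?_
  rw [← YoungDiagram.mem_iff_lt_rowLen, ← YoungDiagram.mem_cells]
  refine ⟨fun hy => ?_, fun hy => ?_⟩
  · obtain ⟨j, -, hj⟩ := (hshape (1, y)).2 (Or.inr ⟨rfl, hy⟩)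
    exact hj ▸ (t.cell j).2
  · simpa using (hshape (1, y)).1 ⟨t.cell.symm ⟨(1, y), hy⟩, Fin.isLt _, by simp⟩

theorem isAdmissible_rowWord (t : Tableau r n μ) : IsAdmissible r n (μ.rowLen 1) t.rowWord := by
  refine ⟨fun m hm => ?_, t.secondCount_rowWord⟩
  have hshape := t.shape_secondCount hm
  have h1 := hshape.1
  have h2 := hshape.2.1
  omega

theorem two_mul_secondCount_le (t : Tableau r n μ) {m : ℕ} (hm : m ≤ n) :
    2 * secondCount t.rowWord m ≤ m := (t.isAdmissible_rowWord.1 m hm).1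

theorem le_two_mul_secondCount (t : Tableau r n μ) {m : ℕ} (hm : m ≤ n) :
    m + 2 ≤ 2 * secondCount t.rowWord m + r := (t.isAdmissible_rowWord.1 m hm).2

theorem rowWord_zero (t : Tableau r n μ) : t.rowWord 0 = false := by
  rcases Nat.eq_zero_or_pos n with rfl | hn
  · rfl
  have hle := t.two_mul_secondCount_le (m := 1) hn
  rw [secondCount_succ, secondCount_zero] at hle
  by_contra hc
  rw [if_pos (eq_true_of_ne_false hc)] at hle
  omega

theorem rowWord_injective : Function.Injective (rowWord : Tableau r n μ → ℕ → Bool) := by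
  refine fun s t h => Tableau.ext (Equiv.ext fun j => Subtype.ext ?_)
  rw [cell_eq_wordCell, cell_eq_wordCell, h]

theorem exists_rowWord_eq (hμ : μ.colLen 0 ≤ 2) (hn : μ.card = n) {w : ℕ → Bool}
    (hw : IsAdmissible r n (μ.rowLen 1) w) :
    ∃ t : Tableau r n μ, ∀ j < n, t.rowWord j = w j := by
  have hrow : n - secondCount w n = μ.rowLen 0 := by
    have := card_eq_of_colLen_le hμ
    have := hw.2
    omega
  have hmem (c : ℕ × ℕ) : c ∈ μ.cells ↔ ∃ j < n, wordCell w j = c := by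
    rw [exists_wordCell_iff, hrow, hw.2, mem_cells_iff_of_colLen_le hμ]
  let f : Fin n → μ.cells := fun j => ⟨wordCell w j, (hmem _).2 ⟨j, j.isLt, rfl⟩⟩
  have hf : Function.Bijective f := by
    rw [Fintype.bijective_iff_surjective_and_card, Fintype.card_fin, Fintype.card_coe]
    refine ⟨fun c => ?_, hn.symm⟩
    obtain ⟨j, hj, hc⟩ := (hmem c).1 c.2
    exact ⟨⟨j, hj⟩, Subtype.ext hc⟩
  have hshape (m : ℕ) (hm : m ≤ n) : ∃ a b, Shape r (Equiv.ofBijective f hf) m a b := by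
    have hbounds := hw.1 m hm
    refine ⟨m - secondCount w m, secondCount w m, by omega, by omega, fun c => ?_⟩
    rw [← exists_wordCell_iff]
    exact ⟨fun ⟨j, hj, h⟩ => ⟨j, hj, h⟩, fun ⟨j, hj, h⟩ => ⟨⟨j, by omega⟩, hj, h⟩⟩
  refine ⟨ofShapes _ hshape, fun j hj => ?_⟩
  rw [rowWord, dif_pos hj]
  change decide ((wordCell w j).1 = 1) = w j
  rw [wordCell]
  cases w j <;> rfl

/-- The content (column minus row) of the cell of an entry. -/
def content (t : Tableau r n μ) (j : Fin n) : ℤ :=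
  ((t.cell j : ℕ × ℕ).2 : ℤ) - ((t.cell j : ℕ × ℕ).1 : ℤ)

theorem d_eq_content_sub (t : Tableau r n μ) (i : Fin (n - 1)) :
    t.d i = t.content (lo i) - t.content (hi i) := by
  rw [d, content, content]
  ring

theorem content_of_second (t : Tableau r n μ) {j : Fin n} (hj : t.rowWord j = true) :
    t.content j = secondCount t.rowWord j - 1 := by
  rw [content, t.cell_eq_wordCell, wordCell, if_pos hj]
  rfl

theorem content_of_first (t : Tableau r n μ) {j : Fin n} (hj : t.rowWord j = false) :
    t.content j = j - secondCount t.rowWord j := by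
  rw [content, t.cell_eq_wordCell, wordCell, if_neg (by simp [hj])]
  simp [secondCount_le]

theorem d_of_eq (t : Tableau r n μ) {i : Fin (n - 1)} (h : t.rowWord i = t.rowWord (i + 1)) :
    t.d i = -1 := by
  have hsucc := secondCount_succ t.rowWord i
  rw [d_eq_content_sub]
  cases hi1 : t.rowWord i <;> rw [hi1] at h hsucc
  · rw [t.content_of_first (j := lo i) hi1, t.content_of_first (j := hi i) h.symm]
    simp [lo, hi, hsucc]
  · rw [t.content_of_second (j := lo i) hi1, t.content_of_second (j := hi i) h.symm]
    simp [lo, hi, hsucc]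

theorem d_of_first_second (t : Tableau r n μ) {i : Fin (n - 1)} (h1 : t.rowWord i = false)
    (h2 : t.rowWord (i + 1) = true) : t.d i = i - 2 * secondCount t.rowWord i + 1 := by
  have hsucc := secondCount_succ t.rowWord i
  rw [d_eq_content_sub, t.content_of_first (j := lo i) h1, t.content_of_second (j := hi i) h2]
  simp only [lo, hi, hsucc, h1, Bool.false_eq_true, if_false]
  omega

theorem d_of_second_first (t : Tableau r n μ) {i : Fin (n - 1)} (h1 : t.rowWord i = true)
    (h2 : t.rowWord (i + 1) = false) : t.d i = 2 * secondCount t.rowWord i - i - 1 := by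
  have hsucc := secondCount_succ t.rowWord i
  rw [d_eq_content_sub, t.content_of_second (j := lo i) h1, t.content_of_first (j := hi i) h2]
  simp only [lo, hi, hsucc, h1, if_true]
  omega

end Tableau

/-- The word that starts with `b` letters `true` in the odd positions, and then has only letters
`false`. -/
def alternatingWord (b : ℕ) (j : ℕ) : Bool := decide (j % 2 = 1 ∧ j < 2 * b)

theorem secondCount_alternatingWord (b m : ℕ) :
    secondCount (alternatingWord b) m = min (m / 2) b := by
  induction m with
  | zero => simp [secondCount_zero]
  | succ m ih =>
    rw [secondCount_succ, ih]
    split_ifs with h <;> simp only [alternatingWord, decide_eq_true_eq] at h <;> omega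

theorem isAdmissible_alternatingWord {r n b : ℕ} (hr : 3 ≤ r) (hb : 2 * b ≤ n)
    (hn : n + 2 ≤ 2 * b + r) : IsAdmissible r n b (alternatingWord b) := by
  simp only [IsAdmissible, secondCount_alternatingWord]
  exact ⟨fun m hm => by omega, by omega⟩

namespace Tableau

variable {r n : ℕ} {μ : YoungDiagram}

theorem exists_rowWord_eq_alternatingWord (hr : 3 ≤ r) (hμ : IsTwoRow r μ) (hn : μ.card = n) :
    ∃ t : Tableau r n μ, ∀ j < n, t.rowWord j = alternatingWord (μ.rowLen 1) j := by
  have hcard := card_eq_of_colLen_le hμ.1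
  have hanti := μ.rowLen_anti 0 1 (by omega)
  have htwo := hμ.2
  exact exists_rowWord_eq hμ.1 hn (isAdmissible_alternatingWord hr (by omega) (by omega))

theorem nonempty (hr : 3 ≤ r) (hμ : IsTwoRow r μ) (hn : μ.card = n) : Nonempty (Tableau r n μ) :=
  (exists_rowWord_eq_alternatingWord hr hμ hn).nonempty

theorem exists_d_zero_eq_one (hr : 3 ≤ r) (hμ : IsTwoRow r μ) (hn : μ.card = n)
    (hpos : 0 < μ.rowLen 1) (hn1 : 0 < n - 1) : ∃ t : Tableau r n μ, t.d ⟨0, hn1⟩ = 1 := by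
  obtain ⟨t, ht⟩ := exists_rowWord_eq_alternatingWord hr hμ hn
  refine ⟨t, ?_⟩
  rw [t.d_of_first_second]
  · simp [secondCount_zero]
  · simp [ht 0 (by omega), alternatingWord]
  · simp [ht 1 (by omega), alternatingWord]
    omega

end Tableau

end RowWords

/-! ### Quantum integers at a root of unity -/

section QuantumIntegers

variable {r : ℕ}

theorem isPrimitiveRoot_q (hr : r ≠ 0) : IsPrimitiveRoot (q r) r :=
  Complex.isPrimitiveRoot_exp r hr

theorem q_ne_zero (r : ℕ) : q r ≠ 0 := Complex.exp_ne_zero _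

theorem star_q (r : ℕ) : star (q r) = (q r)⁻¹ := eq_inv_of_mul_eq_one_right (norm_q r)

theorem q_zpow_ne_zpow {k l : ℤ} (h : k ≠ l) (h0 : -(r : ℤ) < k - l) (h1 : k - l < r) :
    q r ^ k ≠ q r ^ l := by
  rw [Ne, ← div_eq_one_iff_eq (zpow_ne_zero l (q_ne_zero r)), ← zpow_sub₀ (q_ne_zero r),
    (isPrimitiveRoot_q (by omega)).zpow_eq_one_iff_dvd]
  exact fun hd => sub_ne_zero.2 h (Int.eq_zero_of_abs_lt_dvd hd (abs_lt.2 ⟨h0, h1⟩))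

/-- The square root `q^{1/2} = e^{πi/r}` of `q`. -/
noncomputable def qHalf (r : ℕ) : ℂ := Complex.exp (Real.pi * Complex.I / r)

theorem qHalf_ne_zero (r : ℕ) : qHalf r ≠ 0 := Complex.exp_ne_zero _

theorem qHalf_sq (r : ℕ) : qHalf r ^ 2 = q r := by
  rw [qHalf, q, ← Complex.exp_nat_mul]
  ring_nf

theorem qInt_mul_qHalf_sub_inv (hr : 3 ≤ r) (k : ℤ) :
    (qInt r k : ℂ) * (qHalf r - (qHalf r)⁻¹) = qHalf r ^ k - (qHalf r ^ k)⁻¹ := by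
  have hne : qHalf r - (qHalf r)⁻¹ ≠ 0 := by
    rw [Ne, sub_eq_zero, ← mul_eq_one_iff_eq_inv₀ (qHalf_ne_zero r), ← sq, qHalf_sq]
    exact (isPrimitiveRoot_q (by omega)).ne_one (by omega)
  rw [qInt_eq, ← qHalf, div_mul_cancel₀ _ hne, zpow_neg]

theorem one_add_q (hr : 3 ≤ r) : 1 + q r = qHalf r * qInt r 2 := by
  have hcos : ((2 * Real.cos (Real.pi / r) : ℝ) : ℂ) = qHalf r + (qHalf r)⁻¹ := by
    push_cast
    rw [Complex.two_cos, qHalf, ← Complex.exp_neg]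
    ring_nf
  rw [qInt_two hr, hcos, mul_add, mul_inv_cancel₀ (qHalf_ne_zero r), ← sq, qHalf_sq, add_comm]

theorem one_add_q_ne_zero (hr : 3 ≤ r) : 1 + q r ≠ 0 := by
  rw [one_add_q hr]
  exact mul_ne_zero (qHalf_ne_zero r) (Complex.ofReal_ne_zero.2 (two_ne hr))

theorem q_sub_one_add_q_mul_alphaOf (hr : 3 ≤ r) {x : ℤ} (hx : qInt r x ≠ 0) :
    (q r - (1 + q r) * alphaOf r x) * (q r ^ x - 1) = 1 - q r := by
  have h2 : (qInt r 2 : ℂ) ≠ 0 := Complex.ofReal_ne_zero.2 (two_ne hr)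
  have hx' : (qInt r x : ℂ) ≠ 0 := Complex.ofReal_ne_zero.2 hx
  have hz := qHalf_ne_zero r
  have hy := zpow_ne_zero x hz
  have hsq : q r ^ x = (qHalf r ^ x) ^ 2 := by
    rw [← qHalf_sq, ← zpow_natCast, ← zpow_natCast, zpow_comm]
  have h0 := qInt_mul_qHalf_sub_inv hr x
  have h1 := qInt_mul_qHalf_sub_inv hr (x + 1)
  rw [zpow_add_one₀ hz] at h1
  rw [hsq, one_add_q hr, ← qHalf_sq, alphaOf]
  push_cast
  generalize qHalf r ^ x = y at *
  field_simp at h0 h1 ⊢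
  linear_combination qInt r (x + 1) * h0 - qInt r x * h1

theorem qInt_two_sq (hr : 3 ≤ r) : qInt r 2 ^ 2 = qInt r 3 + 1 := by
  rw [sq, qInt_two_mul hr, ← qInt_one hr]
  rfl

theorem qInt_two_sq_ne_one (hr : 4 ≤ r) : qInt r 2 ^ 2 ≠ 1 := by
  rw [qInt_two_sq (by omega), Ne, add_eq_right]
  exact (qInt_pos (by omega) (by omega) (by omega)).ne'

end QuantumIntegers

/-! ### Irreducibility -/

namespace Tableau

variable {r n : ℕ} {μ : YoungDiagram}

theorem content_zero (t : Tableau r n μ) (hn : 0 < n) : t.content ⟨0, hn⟩ = 0 := by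
  rw [t.content_of_first (j := ⟨0, hn⟩) t.rowWord_zero]
  simp [secondCount_zero]

/-- The diagonal operator `q^{content}` attached to an entry, as a function on the tableaux; these
are the Jucys-Murphy elements of the Hecke algebra, up to normalization. -/
noncomputable def qContent (j : Fin n) (t : Tableau r n μ) : ℂ := q r ^ t.content j

theorem qContent_ne_of_second_first {s t : Tableau r n μ} {j : Fin n}
    (h : secondCount s.rowWord j = secondCount t.rowWord j) (hs : s.rowWord j = true)
    (ht : t.rowWord j = false) : qContent j s ≠ qContent j t := by
  have hle := t.two_mul_secondCount_le j.isLt.le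
  have hge := t.le_two_mul_secondCount j.isLt.le
  rw [qContent, qContent, s.content_of_second hs, t.content_of_first ht, h]
  exact q_zpow_ne_zpow (by omega) (by omega) (by omega)

theorem exists_qContent_ne {s t : Tableau r n μ} (h : s ≠ t) :
    ∃ j, qContent j s ≠ qContent j t := by
  classical
  have hex : ∃ j, s.rowWord j ≠ t.rowWord j := Function.ne_iff.1 (rowWord_injective.ne h)
  set j := Nat.find hex
  have hne : s.rowWord j ≠ t.rowWord j := Nat.find_spec hex
  have hj : j < n := by
    by_contra hj
    exact hne (by rw [rowWord, rowWord, dif_neg hj, dif_neg hj])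
  have hcount : secondCount s.rowWord j = secondCount t.rowWord j :=
    secondCount_congr fun i hi => not_not.1 (Nat.find_min hex hi)
  refine ⟨⟨j, hj⟩, ?_⟩
  cases hs : s.rowWord j <;> rw [hs] at hne
  · exact (qContent_ne_of_second_first hcount.symm (Bool.not_eq_false _ ▸ hne.symm) hs).symm
  · exact qContent_ne_of_second_first hcount hs (Bool.not_eq_true _ ▸ hne.symm)

section Exchange

variable {s t : Tableau r n μ} {i : Fin (n - 1)}

theorem cell_lo_of_swapped (h : s.cell = t.swapped i) : s.cell (lo i) = t.cell (hi i) := by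
  simp [h, swapped]

theorem content_lo_of_swapped (h : s.cell = t.swapped i) :
    s.content (lo i) = t.content (hi i) := by
  rw [content, content, cell_lo_of_swapped h]

theorem rowWord_of_swapped (h : s.cell = t.swapped i) : s.rowWord i = t.rowWord (i + 1) := by
  rw [show s.rowWord i = _ from s.rowWord_coe (lo i), cell_lo_of_swapped h, ← rowWord_coe]
  rfl

theorem d_bounds_of_swapped_of_first_second (h : s.cell = t.swapped i)
    (h1 : t.rowWord i = false) (h2 : t.rowWord (i + 1) = true) :
    1 < t.d i ∧ t.d i < r - 1 := by
  have hs1 : s.rowWord i = true := (rowWord_of_swapped h).trans h2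
  have hs2 : s.rowWord (i + 1) = false := (rowWord_of_swapped (swapped_symm h)).symm.trans h1
  have hd := d_of_swapped h
  have hs := s.two_mul_secondCount_le (m := i + 1) (by omega)
  have ht := t.le_two_mul_secondCount (m := i + 1) (by omega)
  rw [s.d_of_second_first hs1 hs2] at hd
  rw [t.d_of_first_second h1 h2] at hd ⊢
  simp only [secondCount_succ, hs1, h1, if_true, Bool.false_eq_true, if_false] at hs ht
  omega

theorem abs_d_of_swapped (h : s.cell = t.swapped i) : 1 < |t.d i| ∧ |t.d i| < r - 1 := by
  have hs1 := rowWord_of_swapped h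
  have hs2 := rowWord_of_swapped (swapped_symm h)
  have hd := d_of_swapped h
  by_cases heq : t.rowWord i = t.rowWord (i + 1)
  · rw [t.d_of_eq heq, s.d_of_eq (hs1.trans (heq.symm.trans hs2))] at hd
    omega
  cases h1 : t.rowWord i
  · have hb := d_bounds_of_swapped_of_first_second h h1 (by simpa [h1] using heq)
    rwa [abs_of_pos (by omega)]
  · have h2 : t.rowWord (i + 1) = false := by simpa [h1] using heq
    have hb := d_bounds_of_swapped_of_first_second (swapped_symm h) (hs1.trans h2) (hs2 ▸ h1)
    rwa [hd, ← abs_of_pos (a := -t.d i) (by omega), abs_neg] at hb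

theorem beta_ne_zero (hr : 3 ≤ r) (h : s.cell = t.swapped i) : t.beta i ≠ 0 := by
  have hd := abs_d_of_swapped h
  have hlt := abs_lt.1 hd.2
  have hgt := lt_abs.1 hd.1
  have h2 := two_ne hr
  have hne := qInt_d hr t i
  have hsq := beta_sq hr t i
  rw [alpha_eq, ← alphaOf_neg hr hne] at hsq
  refine left_ne_zero_of_mul (ne_of_eq_of_ne hsq (mul_ne_zero ?_ ?_))
  · exact div_ne_zero (qInt_ne_zero hr (by omega) (by omega) (by omega)) (mul_ne_zero h2 hne)
  · rw [alphaOf, qInt_neg]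
    exact div_ne_zero (qInt_ne_zero hr (by omega) (by omega) (by omega))
      (mul_ne_zero h2 (neg_ne_zero.2 hne))

theorem G_eq_of_swapped (h : s.cell = t.swapped i) : G i s = t := by
  apply Tableau.ext
  rw [G_spec i s ⟨t, swapped_symm h⟩, ← swapped_symm h]

end Exchange

/-- `s` is obtained from `t` by exchanging two consecutive entries. -/
def IsExchange (s t : Tableau r n μ) : Prop := ∃ i : Fin (n - 1), s.cell = t.swapped i

instance : Std.Symm (IsExchange : Tableau r n μ → Tableau r n μ → Prop) :=
  ⟨fun _ _ ⟨i, h⟩ => ⟨i, swapped_symm h⟩⟩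

/-- A statistic that decreases when an exchange moves an entry of the second row forward. -/
def energy (t : Tableau r n μ) : ℕ := ∑ j : Fin n, j.val * (t.cell j : ℕ × ℕ).1

theorem energy_lt {s t : Tableau r n μ} {i : Fin (n - 1)} (h : s.cell = t.swapped i)
    (h1 : t.rowWord i = false) (h2 : t.rowWord (i + 1) = true) : s.energy < t.energy := by
  have hlo : (t.cell (lo i) : ℕ × ℕ).1 = 0 := by
    rw [t.cell_eq_wordCell, wordCell, show t.rowWord (lo i) = false from h1]
    rfl
  have hhi : (t.cell (hi i) : ℕ × ℕ).1 = 1 := by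
    rw [t.cell_eq_wordCell, wordCell, show t.rowWord (hi i) = true from h2]
    rfl
  have hs : s.energy =
      ∑ j : Fin n, (Equiv.swap (lo i) (hi i) j).val * (t.cell j : ℕ × ℕ).1 := by
    rw [energy, ← Equiv.sum_comp (Equiv.swap (lo i) (hi i))]
    simp [h, swapped]
  rw [hs, energy]
  refine Finset.sum_lt_sum (fun j _ => ?_) ⟨hi i, Finset.mem_univ _, ?_⟩
  · rw [Equiv.swap_apply_def]
    split_ifs with h3 h4
    · rw [h3, hlo, mul_zero, mul_zero]
    · exact Nat.mul_le_mul_right _ (by simp [h4, lo, hi])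
    · exact le_rfl
  · rw [Equiv.swap_apply_right, hhi]
    simp [lo, hi]

theorem exists_swapped_energy_lt {t : Tableau r n μ} {i : Fin (n - 1)} (h : 1 < t.d i) :
    ∃ s : Tableau r n μ, s.cell = t.swapped i ∧ s.energy < t.energy := by
  obtain ⟨s, hs⟩ := t.exists_swap i (by omega) (by omega) (by have := t.d_bounds i; omega)
  have hne : t.rowWord i ≠ t.rowWord (i + 1) := fun heq => by
    rw [t.d_of_eq heq] at h
    omega
  cases h1 : t.rowWord i <;> cases h2 : t.rowWord (i + 1)
  · exact (hne (h1.trans h2.symm)).elim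
  · exact ⟨s, hs, energy_lt hs h1 h2⟩
  · have hle := t.two_mul_secondCount_le (m := i) (by omega)
    rw [t.d_of_second_first h1 h2] at h
    omega
  · exact (hne (h1.trans h2.symm)).elim

theorem exists_forall_d_le_one (t : Tableau r n μ) :
    ∃ s, (∀ i, s.d i ≤ 1) ∧ Relation.ReflTransGen IsExchange s t := by
  induction hN : t.energy using Nat.strong_induction_on generalizing t with
  | _ N ih =>
    by_cases h : ∀ i, t.d i ≤ 1
    · exact ⟨t, h, .refl⟩
    push Not at h
    obtain ⟨i, hi⟩ := h
    obtain ⟨u, hu, hlt⟩ := exists_swapped_energy_lt hi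
    obtain ⟨s, hs, hsu⟩ := ih _ (hN ▸ hlt) u rfl
    exact ⟨s, hs, hsu.tail ⟨i, hu⟩⟩

theorem le_of_forall_d_le_one {t : Tableau r n μ} (ht : ∀ i, t.d i ≤ 1) {m : ℕ} (hm : m < n)
    (h : t.rowWord m = true) : m ≤ 2 * secondCount t.rowWord m + 1 := by
  induction m with
  | zero => omega
  | succ m ih =>
    have hsucc := secondCount_succ t.rowWord m
    cases h1 : t.rowWord m
    · have hd := ht ⟨m, by omega⟩
      rw [t.d_of_first_second (i := ⟨m, by omega⟩) h1 h] at hd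
      simp only [h1, Bool.false_eq_true, if_false] at hsucc
      simp only at hd
      omega
    · have hle := ih (by omega) h1
      rw [h1, if_pos rfl] at hsucc
      omega

theorem rowWord_iff_of_forall_d_le_one {t : Tableau r n μ} (ht : ∀ i, t.d i ≤ 1) {m : ℕ}
    (hm : m < n) : t.rowWord m = true ↔ m + 1 = 2 * secondCount t.rowWord (m + 1) := by
  have hle := t.two_mul_secondCount_le (m := m) (by omega)
  have hle' := t.two_mul_secondCount_le (m := m + 1) (by omega)
  have hge := le_of_forall_d_le_one ht hm
  rw [secondCount_succ] at hle' ⊢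
  cases h : t.rowWord m <;> simp only [h, Bool.false_eq_true, if_false, if_true, true_iff,
    false_iff, forall_const] at hle' hge ⊢ <;> omega

theorem eq_of_forall_d_le_one {s t : Tableau r n μ} (hs : ∀ i, s.d i ≤ 1)
    (ht : ∀ i, t.d i ≤ 1) : s = t := by
  have hword {m : ℕ} (hm : m < n)
      (h : secondCount s.rowWord (m + 1) = secondCount t.rowWord (m + 1)) :
      s.rowWord m = t.rowWord m := by
    rw [Bool.eq_iff_iff, rowWord_iff_of_forall_d_le_one hs hm,
      rowWord_iff_of_forall_d_le_one ht hm, h]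
  have hcount {m : ℕ} (hm : m ≤ n) : secondCount s.rowWord m = secondCount t.rowWord m := by
    induction hm using Nat.decreasingInduction with
    | self => rw [s.secondCount_rowWord, t.secondCount_rowWord]
    | of_succ m hm ih =>
      have hm' := hword hm ih
      rw [secondCount_succ, secondCount_succ, hm'] at ih
      exact Nat.add_right_cancel ih
  refine rowWord_injective (funext fun m => ?_)
  by_cases hm : m < n
  · exact hword hm (hcount hm)
  · rw [rowWord, rowWord, dif_neg hm, dif_neg hm]

theorem reflTransGen_isExchange (s t : Tableau r n μ) : Relation.ReflTransGen IsExchange s t := by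
  obtain ⟨u, hu, hus⟩ := s.exists_forall_d_le_one
  obtain ⟨v, hv, hvt⟩ := t.exists_forall_d_le_one
  rw [← eq_of_forall_d_le_one hu hv] at hvt
  exact (symm hus).trans hvt

end Tableau

section Irreducible

variable {r n : ℕ} {μ : YoungDiagram}

open Tableau

theorem sigmaMatrix_mulVec (hr : 3 ≤ r) (i : Fin (n - 1)) (f : Tableau r n μ → ℂ)
    (t : Tableau r n μ) : (sigmaMatrix r n μ i).mulVec f t =
      (q r - (1 + q r) * t.alpha i) * f t - (1 + q r) * t.beta i * f (G i t) := by
  rw [sigmaMatrix, Matrix.sub_mulVec, Matrix.smul_mulVec, Matrix.smul_mulVec, Matrix.one_mulVec,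
    Pi.sub_apply, Pi.smul_apply, Pi.smul_apply, projector_mulVec hr, smul_eq_mul, smul_eq_mul]
  ring

theorem q_sub_alpha_mul_qContent_sub (hr : 3 ≤ r) (i : Fin (n - 1)) (t : Tableau r n μ) :
    (q r - (1 + q r) * t.alpha i) * (qContent (lo i) t - qContent (hi i) t) =
      (1 - q r) * qContent (hi i) t := by
  have hne : qContent (hi i) t ≠ 0 := zpow_ne_zero _ (q_ne_zero r)
  rw [← q_sub_one_add_q_mul_alphaOf hr (qInt_d hr t i), ← alpha_eq, d_eq_content_sub,
    zpow_sub₀ (q_ne_zero r), ← qContent, ← qContent, mul_assoc, sub_one_mul,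
    div_mul_cancel₀ _ hne]

theorem sigmaMatrix_mulVec_qContent_mul (hr : 3 ≤ r) (i : Fin (n - 1)) (f : Tableau r n μ → ℂ) :
    (sigmaMatrix r n μ i).mulVec (qContent (lo i) * (sigmaMatrix r n μ i).mulVec f) =
      q r • (qContent (hi i) * f) := by
  ext t
  have hbb : (t.beta i : ℂ) * t.beta i = t.alpha i * (1 - t.alpha i) := by
    exact_mod_cast beta_sq hr t i
  have hxy := q_sub_alpha_mul_qContent_sub hr i t
  simp only [sigmaMatrix_mulVec hr, Pi.mul_apply, Pi.smul_apply, smul_eq_mul]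
  by_cases h : ∃ s : Tableau r n μ, s.cell = t.swapped i
  · have hG := G_spec i t h
    rw [G_eq_of_swapped hG, alpha_of_swapped hr hG, beta_of_swapped hr hG,
      show qContent (lo i) (G i t) = qContent (hi i) t by
        rw [qContent, content_lo_of_swapped hG, ← qContent]]
    push_cast
    linear_combination ((q r - (1 + q r) * t.alpha i) * f t
      - (1 + q r) * t.beta i * f (G i t)) * hxy + (1 + q r) ^ 2 * qContent (hi i) t * f t * hbb
  · have hb : t.beta i = 0 := by rcases extreme hr t i h with h | h <;> exact h.2.2
    rw [hb] at hbb ⊢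
    push_cast at hbb ⊢
    linear_combination (q r - (1 + q r) * t.alpha i) * f t * hxy +
      (1 + q r) ^ 2 * qContent (hi i) t * f t * hbb

variable {W : Submodule ℂ (Tableau r n μ → ℂ)}

theorem qContent_mul_mem (hr : 3 ≤ r)
    (hW : ∀ i, ∀ f ∈ W, (sigmaMatrix r n μ i).mulVec f ∈ W) (j : Fin n) :
    ∀ f ∈ W, qContent j * f ∈ W := by
  obtain ⟨j, hj⟩ := j
  induction j with
  | zero =>
    intro f hf
    have hone : (qContent ⟨0, hj⟩ : Tableau r n μ → ℂ) = 1 := by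
      ext t
      rw [qContent, t.content_zero, zpow_zero, Pi.one_apply]
    rwa [hone, one_mul]
  | succ j ih =>
    intro f hf
    rw [← W.smul_mem_iff (q_ne_zero r)]
    exact sigmaMatrix_mulVec_qContent_mul hr (⟨j, by omega⟩ : Fin (n - 1)) f ▸
      hW _ _ (ih (by omega) _ (hW _ f hf))

theorem single_mem (hr : 3 ≤ r) (hW : ∀ i, ∀ f ∈ W, (sigmaMatrix r n μ i).mulVec f ∈ W)
    {f : Tableau r n μ → ℂ} (hf : f ∈ W) {t : Tableau r n μ} (ht : f t ≠ 0) :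
    Pi.single t 1 ∈ W :=
  single_mem_of_mul_mem qContent (qContent_mul_mem hr hW) (fun _ _ => exists_qContent_ne) hf ht

theorem single_mem_of_isExchange (hr : 3 ≤ r)
    (hW : ∀ i, ∀ f ∈ W, (sigmaMatrix r n μ i).mulVec f ∈ W) {s t : Tableau r n μ}
    (h : IsExchange s t) (ht : Pi.single t 1 ∈ W) : Pi.single s 1 ∈ W := by
  obtain ⟨i, hst⟩ := h
  have hne : s ≠ t := by
    rintro rfl
    exact not_swapped_self s i hst
  refine single_mem hr hW (hW i _ ht) ?_
  rw [sigmaMatrix_mulVec hr, G_eq_of_swapped hst, Pi.single_eq_same, Pi.single_eq_of_ne hne]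
  simp [beta_ne_zero hr (swapped_symm hst), one_add_q_ne_zero hr]

theorem eq_bot_or_eq_top_of_invariant (hr : 3 ≤ r)
    (hW : ∀ i, ∀ f ∈ W, (sigmaMatrix r n μ i).mulVec f ∈ W) : W = ⊥ ∨ W = ⊤ := by
  refine or_iff_not_imp_left.2 fun hne => eq_top_iff.2 fun g _ => ?_
  obtain ⟨f, hf, hf0⟩ := W.ne_bot_iff.1 hne
  obtain ⟨t, ht⟩ := Function.ne_iff.1 hf0
  have hsingle (s : Tableau r n μ) : Pi.single s 1 ∈ W := by
    induction reflTransGen_isExchange s t using Relation.ReflTransGen.head_induction_on with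
    | refl => exact single_mem hr hW hf ht
    | head h _ ih => exact single_mem_of_isExchange hr hW h ih
  rw [pi_eq_sum_univ' g]
  exact W.sum_mem fun s _ => W.smul_mem _ (hsingle s)

theorem sector_σ (hr : 3 ≤ r) (i : Fin (n - 1)) :
    sector r n hr μ (BraidGroup.σ i) = sigmaUnitary r n hr μ i := by
  rw [sector, BraidGroup.σ, PresentedGroup.toGroup.of]

theorem sectorRep_σ (hr : 3 ≤ r) (i : Fin (n - 1)) :
    sectorRep r n hr μ (BraidGroup.σ i) = Matrix.toLin' (sigmaMatrix r n μ i) := by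
  change Matrix.toLin' ((sector r n hr μ (BraidGroup.σ i)).val) = _
  rw [sector_σ]
  rfl

theorem sectorRep_isIrreducible (hr : 3 ≤ r) (hμ : IsTwoRow r μ) (hn : μ.card = n) :
    (sectorRep r n hr μ).IsIrreducible := by
  have : Nonempty (Tableau r n μ) := Tableau.nonempty hr hμ hn
  have : Nontrivial (Subrepresentation (sectorRep r n hr μ)) :=
    ⟨⊥, ⊤, fun h => bot_ne_top (congrArg Subrepresentation.toSubmodule h :
      (⊥ : Submodule ℂ (Tableau r n μ → ℂ)) = ⊤)⟩
  refine { eq_bot_or_eq_top := fun U => ?_ }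
  have hU (i : Fin (n - 1)) (f : Tableau r n μ → ℂ) (hf : f ∈ U.toSubmodule) :
      (sigmaMatrix r n μ i).mulVec f ∈ U.toSubmodule := by
    rw [← Matrix.toLin'_apply, ← sectorRep_σ hr]
    exact U.apply_mem_toSubmodule _ hf
  exact (eq_bot_or_eq_top_of_invariant hr hU).imp
    (fun h => Subrepresentation.toSubmodule_injective h)
    (fun h => Subrepresentation.toSubmodule_injective h)

end Irreducible

/-! ### Infinite image -/

theorem exists_algHom_apply_eq_pow {E K : Type*} [Field E] [Algebra ℚ E] [Algebra.IsAlgebraic ℚ E]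
    [Field K] [Algebra ℚ K] [IsAlgClosed K] (ι : E →ₐ[ℚ] K) {n k : ℕ} (hn : 0 < n) {ζ : E}
    (hζ : IsPrimitiveRoot ζ n) (hk : k.Coprime n) : ∃ σ : E →ₐ[ℚ] K, σ ζ = ι ζ ^ k := by
  have : CharZero E := algebraRat.charZero E
  have hmin : minpoly ℚ ζ = minpoly ℚ (ζ ^ k) := by
    rw [minpoly.isIntegrallyClosed_eq_field_fractions' ℚ (hζ.isIntegral hn),
      minpoly.isIntegrallyClosed_eq_field_fractions' ℚ ((hζ.isIntegral hn).pow k),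
      hζ.minpoly_eq_pow_coprime hk]
  refine IntermediateField.exists_algHom_of_splits_of_aeval
    (fun x => ⟨Algebra.IsIntegral.isIntegral x, IsAlgClosed.splits _⟩) ?_
  rw [hmin, ← map_pow, Polynomial.aeval_algHom_apply, minpoly.aeval, map_zero]

theorem exists_pow_eq_one_of_add_eq {x p : ℂ} {r k N : ℕ} (hp : IsPrimitiveRoot p r) (hr : 0 < r)
    (hk : k.Coprime r) (hN : 0 < N) (hxN : x ^ N = 1) (hx : x + x⁻¹ = 1 - p - p⁻¹) :
    ∃ y : ℂ, y ^ N = 1 ∧ y + y⁻¹ = 1 - p ^ k - (p ^ k)⁻¹ := by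
  have mem_of_pow {z : ℂ} {m : ℕ} (hm : 0 < m) (hz : z ^ m = 1) : z ∈ algebraicClosure ℚ ℂ :=
    mem_algebraicClosure_iff.2 (IsIntegral.of_pow hm (hz ▸ isIntegral_one)).isAlgebraic
  lift x to algebraicClosure ℚ ℂ using mem_of_pow hN hxN
  lift p to algebraicClosure ℚ ℂ using mem_of_pow hr hp.pow_eq_one
  obtain ⟨σ, hσ⟩ := exists_algHom_apply_eq_pow (algebraicClosure ℚ ℂ).val hr
    (IsPrimitiveRoot.coe_submonoidClass_iff.1 hp) hk
  refine ⟨σ x, ?_, ?_⟩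
  · rw [← map_pow, ← map_one σ]
    exact congrArg σ (Subtype.ext hxN)
  · have hx' : x + x⁻¹ = 1 - p - p⁻¹ := Subtype.ext hx
    simpa only [map_add, map_sub, map_inv₀, map_one, hσ,
      IntermediateField.coe_val] using congrArg σ hx'

theorem exists_coprime_near_half {r : ℕ} (hr : 5 ≤ r) (h6 : r ≠ 6) (h10 : r ≠ 10) :
    ∃ k j : ℕ, 2 * k + j = r ∧ 3 * j < r ∧ k.Coprime r := by
  have coprime_of_coprime {k j : ℕ} (h : 2 * k + j = r) (hc : k.Coprime j) : k.Coprime r := by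
    rw [← h]
    exact (Nat.coprime_mul_right_add_right k j 2).2 hc
  have coprime_of_odd {k : ℕ} (m : ℕ) (hk : Odd k) : k.Coprime (2 ^ m) :=
    (Nat.coprime_two_right.2 hk).pow_right m
  obtain ⟨s, hs | hs⟩ := Nat.even_or_odd' r
  · obtain ⟨u, hu | hu⟩ := Nat.even_or_odd' s
    · exact ⟨s - 1, 2 ^ 1, by omega, by omega,
        coprime_of_coprime (by omega) (coprime_of_odd 1 ⟨u - 1, by omega⟩)⟩
    · exact ⟨s - 2, 2 ^ 2, by omega, by omega,
        coprime_of_coprime (by omega) (coprime_of_odd 2 ⟨u - 1, by omega⟩)⟩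
  · exact ⟨s, 1, by omega, by omega,
      coprime_of_coprime (by omega) (Nat.coprime_one_right s)⟩

theorem q_pow_re (r k : ℕ) : (q r ^ k).re = Real.cos (k * (2 * Real.pi / r)) := by
  have hexp : q r ^ k = Complex.exp ((k * (2 * Real.pi / r) : ℝ) * Complex.I) := by
    rw [q, ← Complex.exp_nat_mul]
    push_cast
    ring_nf
  rw [hexp, Complex.exp_ofReal_mul_I_re]

theorem q_pow_re_lt {r k j : ℕ} (h : 2 * k + j = r) (h3 : 3 * j < r) :
    (q r ^ k).re < -(1 / 2) := by
  have hr : (0 : ℝ) < r := by exact_mod_cast (by omega : 0 < r)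
  have h3' : (3 : ℝ) * j < r := by exact_mod_cast h3
  have hk : (2 : ℝ) * k + j = r := by exact_mod_cast h
  have hangle : (k : ℝ) * (2 * Real.pi / r) = Real.pi - j * Real.pi / r := by
    field_simp
    linear_combination hk
  rw [q_pow_re, hangle, Real.cos_pi_sub, ← Real.cos_pi_div_three, neg_lt_neg_iff]
  refine Real.cos_lt_cos_of_nonneg_of_le_pi (by positivity) (by linarith [Real.pi_pos]) ?_
  rw [div_lt_div_iff₀ hr (by norm_num)]
  nlinarith [Real.pi_pos]

theorem re_inv_of_norm_eq_one {z : ℂ} (hz : ‖z‖ = 1) : (z⁻¹).re = z.re := by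
  rw [Complex.inv_re, Complex.normSq_eq_norm_sq, hz, one_pow, div_one]

/-- A Galois conjugate of `x` would be a root of unity `y` with `Re (y + y⁻¹) > 2`. -/
theorem pow_ne_one_of_add_inv_eq {r : ℕ} (hr : 5 ≤ r) (h6 : r ≠ 6) (h10 : r ≠ 10) {x : ℂ}
    (hx : x + x⁻¹ = 1 - q r - (q r)⁻¹) {N : ℕ} (hN : 0 < N) : x ^ N ≠ 1 := by
  intro hxN
  obtain ⟨k, j, hkj, h3, hk⟩ := exists_coprime_near_half hr h6 h10
  have hq := isPrimitiveRoot_q (r := r) (by omega)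
  obtain ⟨y, hyN, hy⟩ := exists_pow_eq_one_of_add_eq hq (by omega) hk hN hxN hx
  have hynorm : ‖y‖ = 1 := Complex.norm_eq_one_of_pow_eq_one hyN hN.ne'
  have hqnorm : ‖q r ^ k‖ = 1 := by
    rw [norm_pow, Complex.norm_eq_one_of_pow_eq_one hq.pow_eq_one (by omega), one_pow]
  have hre := congrArg Complex.re hy
  simp only [Complex.add_re, Complex.sub_re, Complex.one_re, re_inv_of_norm_eq_one hynorm,
    re_inv_of_norm_eq_one hqnorm] at hre
  linarith [q_pow_re_lt hkj h3, Complex.re_le_norm y]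

theorem exists_mul_eq_one_add_eq {K : Type*} [Field K] [NeZero (2 : K)] [IsAlgClosed K] (c : K) :
    ∃ x y : K, x * y = 1 ∧ x + y = c := by
  obtain ⟨s, hs⟩ := IsAlgClosed.exists_pow_nat_eq (c ^ 2 - 4) two_pos
  have h2 : (2 : K) ≠ 0 := NeZero.ne _
  refine ⟨(c + s) / 2, (c - s) / 2, ?_, ?_⟩
  · field_simp
    linear_combination -hs
  · field_simp
    ring

section Projectors

variable {r n : ℕ} {μ : YoungDiagram}

theorem inv_qInt_two_sq_ne_zero (hr : 3 ≤ r) : (((qInt r 2 : ℝ) : ℂ) ^ 2)⁻¹ ≠ 0 :=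
  inv_ne_zero (pow_ne_zero 2 (Complex.ofReal_ne_zero.2 (two_ne hr)))

theorem inv_qInt_two_sq_ne_one (hr : 4 ≤ r) : (((qInt r 2 : ℝ) : ℂ) ^ 2)⁻¹ ≠ 1 :=
  inv_ne_one.2 (by exact_mod_cast qInt_two_sq_ne_one hr)

theorem isTemperleyLiebPair_projector (hr : 3 ≤ r) {i j : Fin (n - 1)}
    (hij : i.val + 1 = j.val) :
    IsTemperleyLiebPair (((qInt r 2 : ℝ) : ℂ) ^ 2)⁻¹ (projector r n μ i) (projector r n μ j) where
  idem_left := projector_mul_self hr i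
  idem_right := projector_mul_self hr j
  left_right_left := projector_braid hr i j (Or.inl hij)
  right_left_right := projector_braid hr j i (Or.inr hij)

theorem projector_ne_zero (hr : 3 ≤ r) (hμ : IsTwoRow r μ) (hn : μ.card = n)
    (hpos : 0 < μ.rowLen 1) (i : Fin (n - 1)) : projector r n μ i ≠ 0 := by
  have hn1 : 0 < n - 1 := i.pos
  have hzero : projector r n μ ⟨0, hn1⟩ ≠ 0 := by
    obtain ⟨t, ht⟩ := Tableau.exists_d_zero_eq_one hr hμ hn hpos hn1
    intro h
    have htt := congrFun (congrFun h t) t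
    rw [projector, Matrix.of_apply, if_pos rfl, Tableau.alpha_eq, ht, alphaOf_one hr] at htt
    simp at htt
  have hiff := eq_of_forall_succ_eq (f := fun i => projector r n μ i ≠ 0) (fun i j hij =>
    propext ((isTemperleyLiebPair_projector hr hij).left_ne_zero_iff (inv_qInt_two_sq_ne_zero hr)))
    i ⟨0, hn1⟩
  exact hiff.mpr hzero

theorem not_commute_pow_hecke_projector (hr : 5 ≤ r) (h6 : r ≠ 6) (h10 : r ≠ 10)
    (hμ : IsTwoRow r μ) (hc : μ.card = n) (hpos : 0 < μ.rowLen 1) {i j : Fin (n - 1)}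
    (hij : i.val + 1 = j.val) {N : ℕ} (hN : 0 < N) :
    ¬Commute ((hecke (q r) (projector r n μ i) * hecke (q r)⁻¹ (projector r n μ j)) ^ N)
      (projector r n μ i) := by
  intro hcomm
  have hr3 : 3 ≤ r := by omega
  obtain ⟨x, y, hxy, hsum⟩ := exists_mul_eq_one_add_eq (1 - q r - (q r)⁻¹)
  have hτ : (1 + q r) ^ 2 * (((qInt r 2 : ℝ) : ℂ) ^ 2)⁻¹ = q r := by
    rw [q_qInt hr3, mul_inv_cancel_right₀]
    exact pow_ne_zero 2 (Complex.ofReal_ne_zero.2 (two_ne hr3))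
  refine pow_ne_one_of_add_inv_eq hr h6 h10 (x := x) ?_ (Nat.mul_pos two_pos hN)
    ((isTemperleyLiebPair_projector hr3 hij).pow_two_mul_eq_one_of_commute
      (mul_inv_cancel₀ (q_ne_zero r)) (one_add_q_ne_zero hr3) hτ (inv_qInt_two_sq_ne_zero hr3)
      (inv_qInt_two_sq_ne_one (by omega)) (projector_ne_zero hr3 hμ hc hpos i) hxy hsum hcomm)
  rw [← eq_inv_of_mul_eq_one_right hxy, hsum]

end Projectors

section FirstTwo

variable {r n : ℕ} {μ : YoungDiagram}

theorem sigmaUnitary_zero_mem_firstTwo (hr : 3 ≤ r) (hn : 3 ≤ n) :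
    sigmaUnitary r n hr μ ⟨0, by omega⟩ ∈ firstTwo r n hr hn μ := by
  rw [← sector_σ]
  exact Subgroup.subset_closure (Or.inl rfl)

theorem sigmaUnitary_one_mem_firstTwo (hr : 3 ≤ r) (hn : 3 ≤ n) :
    sigmaUnitary r n hr μ ⟨1, by omega⟩ ∈ firstTwo r n hr hn μ := by
  rw [← sector_σ]
  exact Subgroup.subset_closure (Or.inr rfl)

theorem coe_inv_sigmaUnitary (hr : 3 ≤ r) (i : Fin (n - 1)) :
    (((sigmaUnitary r n hr μ i)⁻¹ : Matrix.unitaryGroup (Tableau r n μ) ℂ) :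
      Matrix (Tableau r n μ) (Tableau r n μ) ℂ) = hecke (q r)⁻¹ (projector r n μ i) := by
  change star (sigmaMatrix r n μ i) = _
  rw [sigmaMatrix, star_sub, star_smul, star_smul, star_one, projector_star hr, star_add,
    star_one, star_q, hecke]

theorem infinite_firstTwo_mod_center (hr : 3 ≤ r) (h3 : r ≠ 3) (h4 : r ≠ 4) (h6 : r ≠ 6)
    (h10 : r ≠ 10) (hn : 3 ≤ n) (hμ : IsTwoRow r μ) (hc : μ.card = n) (hpos : 0 < μ.rowLen 1) :
    Infinite ((firstTwo r n hr hn μ).map (QuotientGroup.mk'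
      (Subgroup.center (Matrix.unitaryGroup (Tableau r n μ) ℂ)))) ∧
    Infinite (firstTwo r n hr hn μ ⧸ Subgroup.center (firstTwo r n hr hn μ)) := by
  let ι := (Matrix.unitaryGroup (Tableau r n μ) ℂ).subtype
  let g := sigmaUnitary r n hr μ ⟨0, by omega⟩
  let h := sigmaUnitary r n hr μ ⟨1, by omega⟩
  have hg : g ∈ firstTwo r n hr hn μ := sigmaUnitary_zero_mem_firstTwo hr hn
  have hh : h ∈ firstTwo r n hr hn μ := sigmaUnitary_one_mem_firstTwo hr hn
  have hncomm (N : ℕ) (hN : 0 < N) : ¬Commute (ι (g * h⁻¹) ^ N) (ι g) := by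
    have hι : ι (g * h⁻¹) = hecke (q r) (projector r n μ ⟨0, by omega⟩) *
        hecke (q r)⁻¹ (projector r n μ ⟨1, by omega⟩) :=
      (map_mul ι g h⁻¹).trans (congrArg (ι g * ·) (coe_inv_sigmaUnitary hr _))
    rw [hι]
    exact (commute_hecke_iff (one_add_q_ne_zero hr)).not.mpr
      (not_commute_pow_hecke_projector (by omega) h6 h10 hμ hc hpos rfl hN)
  have mem_mul := mul_mem hg (inv_mem hh)
  constructor
  · refine infinite_map_mk_center mem_mul (h := g) fun N hN hcomm => hncomm N hN ?_
    rw [← map_pow]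
    exact hcomm.map ι
  · refine infinite_quotient_center (g := (⟨_, mem_mul⟩ : firstTwo r n hr hn μ))
      (h := ⟨_, hg⟩) fun N hN hcomm => hncomm N hN ?_
    rw [← map_pow]
    exact (hcomm.map (firstTwo r n hr hn μ).subtype).map ι

end FirstTwo

/-! ### Eigenvalues and multiplicities -/

section Eigenvalues

variable {r n : ℕ} {μ : YoungDiagram}

theorem sectorRep_σ_eq_hecke (hr : 3 ≤ r) (i : Fin (n - 1)) :
    sectorRep r n hr μ (BraidGroup.σ i) = hecke (q r) (Matrix.toLin' (projector r n μ i)) := by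
  rw [sectorRep_σ, sigmaMatrix, hecke, map_sub, map_smul, map_smul, Matrix.toLin'_one]
  rfl

theorem isIdempotentElem_toLin'_projector (hr : 3 ≤ r) (i : Fin (n - 1)) :
    IsIdempotentElem (Matrix.toLin' (projector r n μ i)) := by
  rw [IsIdempotentElem, Module.End.mul_eq_comp, ← Matrix.toLin'_mul, projector_mul_self hr]

theorem eq_of_hasEigenvalue_sectorRep_σ (hr : 3 ≤ r) (i : Fin (n - 1)) {z : ℂ}
    (hz : Module.End.HasEigenvalue (sectorRep r n hr μ (BraidGroup.σ i)) z) :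
    z = -1 ∨ z = q r := by
  rw [sectorRep_σ_eq_hecke] at hz
  exact eq_of_hasEigenvalue_hecke (isIdempotentElem_toLin'_projector hr i) hz

theorem projector_ne_one (hr : 4 ≤ r) (hn : 3 ≤ n) (hμ : IsTwoRow r μ) (hc : μ.card = n)
    (hpos : 0 < μ.rowLen 1) (i : Fin (n - 1)) : projector r n μ i ≠ 1 := by
  have hτ := inv_qInt_two_sq_ne_one hr
  have hne := projector_ne_zero (by omega : 3 ≤ r) hμ hc hpos
  by_cases hi : i.val + 1 < n - 1
  · exact (isTemperleyLiebPair_projector (j := ⟨i + 1, hi⟩) (by omega) rfl).left_ne_one hτ (hne _)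
  · exact (isTemperleyLiebPair_projector (i := ⟨i - 1, by omega⟩) (j := i) (by omega)
      (Nat.sub_add_cancel (by omega))).symm.left_ne_one hτ (hne _)

theorem hasEigenvalue_sectorRep_σ_iff (hr : 4 ≤ r) (hn : 3 ≤ n) (hμ : IsTwoRow r μ)
    (hc : μ.card = n) (hpos : 0 < μ.rowLen 1) (i : Fin (n - 1)) (z : ℂ) :
    Module.End.HasEigenvalue (sectorRep r n (by omega) μ (BraidGroup.σ i)) z ↔
      z = -1 ∨ z = q r := by
  have hr3 : 3 ≤ r := by omega
  rw [sectorRep_σ_eq_hecke]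
  refine hasEigenvalue_hecke_iff (one_add_q_ne_zero hr3)
    (isIdempotentElem_toLin'_projector hr3 i) ?_ ?_ z
  · exact (LinearEquiv.map_ne_zero_iff _).2 (projector_ne_zero hr3 hμ hc hpos i)
  · rw [Module.End.one_eq_id, ← Matrix.toLin'_one]
    exact Matrix.toLin'.injective.ne (projector_ne_one hr hn hμ hc hpos i)

theorem trace_projector_zero (hr : 3 ≤ r) (h0 : 0 < n - 1) :
    (projector r n μ ⟨0, h0⟩).trace =
      ((Finset.univ.filter fun t : Tableau r n μ => t.rowWord 1 = true).card : ℂ) := by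
  rw [Matrix.trace, Finset.card_filter, Nat.cast_sum]
  refine Finset.sum_congr rfl fun t _ => ?_
  rw [Matrix.diag_apply, projector, Matrix.of_apply, if_pos rfl, Tableau.alpha_eq]
  split_ifs with hsecond
  · rw [t.d_of_first_second t.rowWord_zero hsecond, secondCount_zero]
    simpa using alphaOf_one hr
  · rw [t.d_of_eq (t.rowWord_zero.trans (eq_false_of_ne_true hsecond).symm), alphaOf_neg_one]
    simp

theorem finrank_eigenspace_sectorRep_σ_neg_one (hr : 3 ≤ r) (i : Fin (n - 1)) :
    Module.finrank ℂ (Module.End.eigenspace (sectorRep r n hr μ (BraidGroup.σ i)) (-1)) =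
      (Finset.univ.filter fun t : Tableau r n μ => t.rowWord 1 = true).card := by
  have htrace := eq_of_forall_succ_eq (f := fun i => (projector r n μ i).trace)
    (fun i j hij => (isTemperleyLiebPair_projector hr hij).trace_eq (inv_qInt_two_sq_ne_zero hr))
    i ⟨0, i.pos⟩
  rw [sectorRep_σ_eq_hecke, ← Nat.cast_inj (R := ℂ), finrank_eigenspace_hecke_neg_one
    (one_add_q_ne_zero hr) (isIdempotentElem_toLin'_projector hr i), Matrix.trace_toLin'_eq]
  exact htrace.trans (trace_projector_zero hr i.pos)

theorem finrank_eigenspace_sectorRep_σ_add (hr : 3 ≤ r) (i : Fin (n - 1)) :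
    Module.finrank ℂ (Module.End.eigenspace (sectorRep r n hr μ (BraidGroup.σ i)) (-1)) +
      Module.finrank ℂ (Module.End.eigenspace (sectorRep r n hr μ (BraidGroup.σ i)) (q r)) =
      Fintype.card (Tableau r n μ) := by
  rw [sectorRep_σ_eq_hecke, finrank_eigenspace_hecke_add (one_add_q_ne_zero hr)
    (isIdempotentElem_toLin'_projector hr i), Module.finrank_fintype_fun_eq_card]

end Eigenvalues

section Counting

variable {r n : ℕ} {μ : YoungDiagram}

/-- The infinite word with first letters `w` and all others `false`; admissibility of finite words
is expressed through it. -/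
def extendWord (w : Fin n → Bool) (j : ℕ) : Bool := if h : j < n then w ⟨j, h⟩ else false

instance (r n b : ℕ) : DecidablePred (IsAdmissible r n b) := fun _ =>
  inferInstanceAs (Decidable (_ ∧ _))

theorem Tableau.extendWord_rowWord (t : Tableau r n μ) :
    extendWord (fun j : Fin n => t.rowWord j) = t.rowWord := by
  ext j
  by_cases hj : j < n <;> simp [extendWord, rowWord, hj]

theorem Tableau.card_filter_rowWord (hμ : μ.colLen 0 ≤ 2) (hn : μ.card = n)
    (P : (ℕ → Bool) → Prop) [DecidablePred P] :
    (Finset.univ.filter fun t : Tableau r n μ => P t.rowWord).card =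
      (Finset.univ.filter fun w : Fin n → Bool =>
        IsAdmissible r n (μ.rowLen 1) (extendWord w) ∧ P (extendWord w)).card := by
  refine Finset.card_nbij (fun t j => t.rowWord j) (fun t ht => ?_) (fun s _ t _ hst => ?_)
    (fun w hw => ?_)
  · simpa [t.extendWord_rowWord, t.isAdmissible_rowWord] using ht
  · rw [← rowWord_injective.eq_iff, ← s.extendWord_rowWord, ← t.extendWord_rowWord]
    exact congrArg extendWord hst
  · simp only [Finset.coe_filter, Finset.mem_univ, true_and, Set.mem_ofPred_eq] at hw
    obtain ⟨t, ht⟩ := exists_rowWord_eq hμ hn hw.1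
    have htw : (fun j : Fin n => t.rowWord j) = w := by
      ext j
      rw [ht j j.isLt, extendWord, dif_pos j.isLt]
    have hext : extendWord w = t.rowWord := by rw [← htw, t.extendWord_rowWord]
    exact ⟨t, by simpa [hext] using hw.2, htw⟩

theorem colLen_diagram42 : diagram42.colLen 0 ≤ 2 := by
  by_contra hc
  have hmem : (2, 0) ∈ diagram42 := YoungDiagram.mem_iff_lt_colLen.2 (by omega)
  simp [diagram42, YoungDiagram.mem_ofRowLens] at hmem

theorem rowLen_zero_diagram42 : diagram42.rowLen 0 = 4 :=
  YoungDiagram.rowLen_ofRowLens (w := [4, 2]) ⟨0, by simp⟩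

theorem rowLen_one_diagram42 : diagram42.rowLen 1 = 2 :=
  YoungDiagram.rowLen_ofRowLens (w := [4, 2]) ⟨1, by simp⟩

theorem card_diagram42 : diagram42.card = 6 := by
  rw [card_eq_of_colLen_le colLen_diagram42, rowLen_zero_diagram42, rowLen_one_diagram42]

theorem card_tableau_diagram42 : Fintype.card (Tableau 5 6 diagram42) = 8 := by
  have hcard := Tableau.card_filter_rowWord (r := 5) colLen_diagram42 card_diagram42
    fun _ => True
  rw [Finset.filter_true, Finset.card_univ, rowLen_one_diagram42] at hcard
  rw [hcard]
  decide

theorem card_tableau_diagram42_rowWord_one :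
    (Finset.univ.filter fun t : Tableau 5 6 diagram42 => t.rowWord 1 = true).card = 3 := by
  rw [Tableau.card_filter_rowWord colLen_diagram42 card_diagram42 fun w => w 1 = true,
    rowLen_one_diagram42]
  decide

theorem finrank_eigenspaces_diagram42 (hr : 3 ≤ 5) (i : Fin (6 - 1)) :
    Module.finrank ℂ (Module.End.eigenspace
      (sectorRep 5 6 hr diagram42 (BraidGroup.σ i)) (-1)) = 3 ∧
    Module.finrank ℂ (Module.End.eigenspace
      (sectorRep 5 6 hr diagram42 (BraidGroup.σ i)) (q 5)) = 5 := by
  have hneg := finrank_eigenspace_sectorRep_σ_neg_one (μ := diagram42) hr i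
  have hsum := finrank_eigenspace_sectorRep_σ_add (μ := diagram42) hr i
  rw [card_tableau_diagram42_rowWord_one] at hneg
  rw [card_tableau_diagram42] at hsum
  exact ⟨hneg, by omega⟩

end Counting

end JonesSector

open JonesSector in
theorem theorem3p1 :
    -- (i) irreducibility
    (∀ (r n : ℕ) (hr : 3 ≤ r) (μ : YoungDiagram), IsTwoRow r μ → μ.card = n →
      (sectorRep r n hr μ).IsIrreducible) ∧
    -- (ii) infinite modulo centre: in the quotient of the unitary group by its centre,
    -- and modulo the centre of the group itself
    (∀ (r n : ℕ) (hr : 3 ≤ r) (hn : 3 ≤ n) (μ : YoungDiagram), IsTwoRow r μ → μ.card = n →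
      0 < μ.rowLen 1 → r ≠ 3 → r ≠ 4 → r ≠ 6 → r ≠ 10 →
      Infinite ((firstTwo r n hr hn μ).map (QuotientGroup.mk'
        (Subgroup.center (Matrix.unitaryGroup (Tableau r n μ) ℂ)))) ∧
      Infinite (firstTwo r n hr hn μ ⧸ Subgroup.center (firstTwo r n hr hn μ))) ∧
    -- (iii) the eigenvalues
    (∀ (r n : ℕ) (hr : 3 ≤ r) (μ : YoungDiagram), IsTwoRow r μ → μ.card = n →
      (-1 : ℂ) ≠ q r ∧
      ∀ i : Fin (n - 1),
        (∀ z : ℂ, Module.End.HasEigenvalue (sectorRep r n hr μ (BraidGroup.σ i)) z →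
          z = -1 ∨ z = q r) ∧
        (4 ≤ r → 3 ≤ n → 0 < μ.rowLen 1 →
          ∀ z : ℂ, Module.End.HasEigenvalue (sectorRep r n hr μ (BraidGroup.σ i)) z ↔
            z = -1 ∨ z = q r)) ∧
    -- (iv) the multiplicities for `r = 5`, `λ = [4, 2]`, `n = 6`
    (∀ i : Fin (6 - 1),
      Module.finrank ℂ (Module.End.eigenspace
        (sectorRep 5 6 (by omega) diagram42 (BraidGroup.σ i)) (-1)) = 3 ∧
      Module.finrank ℂ (Module.End.eigenspace
        (sectorRep 5 6 (by omega) diagram42 (BraidGroup.σ i)) (q 5)) = 5) := by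
  refine ⟨fun r n hr μ hμ hc => sectorRep_isIrreducible hr hμ hc,
    fun r n hr hn μ hμ hc hpos h3 h4 h6 h10 =>
      infinite_firstTwo_mod_center hr h3 h4 h6 h10 hn hμ hc hpos,
    fun r n hr μ hμ hc => ⟨fun h => ?_, fun i => ⟨fun z => eq_of_hasEigenvalue_sectorRep_σ hr i,
      fun hr4 hn hpos z => hasEigenvalue_sectorRep_σ_iff hr4 hn hμ hc hpos i z⟩⟩,
    finrank_eigenspaces_diagram42 _⟩
  exact one_add_q_ne_zero hr (by rw [← h, add_neg_cancel])
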